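/- For an integer $m\ge 0$ let $\mathbf C[X,Y]_m$ be the space of homogeneous polynomials of degree $m$, with the bilinear pairing $\langle X^iY^{m-i},X^jY^{m-j}\rangle_m=(-1)^i\binom{m}{i}^{-1}$ if $i+j=m$ and $0$ otherwise; for $m$ even let $(X^iY^{m-i})^\vee$ denote the basis dual to the monomials with respect to this pairing. For $g\in{\rm GL}_2(\mathbf C)$ put $(\rho(g)P)(X,Y)=P((X,Y)g)$. Let $K_s(z)=\frac12\int_0^\infty \exp(-\frac z2(u+\frac1u))\,u^{s-1}\,{\rm d}u$ for ${\rm Re}(z)>0$. Let $n\ge 0$ be an even integer. (a) $W_n:{\rm GL}_2(\mathbf C)\to\mathbf C[X,Y]_{2n+2}$ is the function determined by $$W_n\left(z\begin{pmatrix}1&x\\0&1\end{pmatrix}\begin{pmatrix}t&0\\0&1\end{pmatrix}u\right)=e^{2\pi\sqrt{-1}(x+\bar x)}\,\rho(u^{-1})\,2^4\sum_{j=-n-1}^{n+1}\sqrt{-1}^{\,j}\,t^{n+2}K_j(4\pi t)\,(X^{n+1+j}Y^{n+1-j})^\vee$$ for $z\in\mathbf C^\times$, $x\in\mathbf C$,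 $t>0$, $u\in{\rm SU}_2$. (b) $V_\infty=\left\{\begin{pmatrix}p&\sqrt{-1}q\\\sqrt{-1}r&\bar p\end{pmatrix}: p\in\mathbf C,\ q,r\in\mathbf R\right\}$ and $\mathbf X_\infty=V_\infty\oplus V_\infty$, where ${\rm d}x$ is the Lebesgue measure in the eight real coordinates ${\rm Re}\,p_i,{\rm Im}\,p_i,q_i,r_i$ $(i=1,2)$. A matrix $h\in {\rm SL}_2(\mathbf C)$ acts on $V_\infty$ by $h\cdot y=h\,y\,\bar h^{*}$, where $\begin{pmatrix}a&b\\c&d\end{pmatrix}^*=\begin{pmatrix}d&-b\\-c&a\end{pmatrix}$, and on $\mathbf X_\infty$ componentwise; we write $hx$ for this action. (c) For a $2\times2$ matrix $y$ put $y^{s}=\frac12(y+{}^{\rm t}y)$; for a symmetric matrix put $\mathbf p\begin{pmatrix}a&b\\b&c\end{pmatrix}=aX^2+2bXY+cY^2$; let $w_0=\begin{pmatrix}0&1\\-1&0\end{pmatrix}$. Define $\varphi_n:\mathbf X_\infty\to\mathbf C[X,Y]_{2n+2}\otimes\mathbf C[X,Y]_n$ by $$\varphi_n(x_1,x_2)=e^{-\pi{\rm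 Tr}(x_1{}^{\rm t}\overline{x_1}+x_2{}^{\rm t}\overline{x_2})}\sum_{\alpha=0}^n \mathbf p\big((x_1^{s}w_0x_2^{s})^{s}\big)\,\mathbf p(x_1^{s})^{\alpha}\,\mathbf p(x_2^{s})^{n-\alpha}\otimes\binom n\alpha X^\alpha Y^{n-\alpha}.$$ (d) Write $\langle\cdot,\cdot\rangle_{\mathcal W}$ for the contraction of the factor $\mathbf C[X,Y]_{2n+2}$ by $\langle\cdot,\cdot\rangle_{2n+2}$, write $\langle\cdot,\cdot\rangle_{\mathcal L}=\langle\cdot,\cdot\rangle_n$, and let the bar denote complex conjugation of the coefficients. Put $$I_n=\int_0^1\frac{(a-a^{-1})^2\,{\rm d}a}{a}\int_{\mathbf X_\infty}{\rm d}x\int_0^\infty\frac{{\rm d}t}{t}\left\langle\left\langle\varphi_n\!\left(\begin{pmatrix}a^{-1/2}&0\\0&a^{1/2}\end{pmatrix}x\right),W_n\!\left(\begin{pmatrix}t&0\\0&1\end{pmatrix}\begin{pmatrix}a^{1/2}&0\\0&a^{-1/2}\end{pmatrix}\right)\right\rangle_{\mathcal W},\overline{\left\langle\varphi_n(x),W_n\!\begin{pmatrix}t&0\\0&1\end{pmatrix}\right\rangle_{\mathcal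 W}}\right\rangle_{\mathcal L}.$$ Proposition. For $n=0$ the successive integrals in $I_0$ converge absolutely, and $I_0=2^{-8}\pi^{-6}$. Hence the conjectural formula $$I_n=(-1)^{n/2}\,2^{-4n-8}\,(n+1)!^2\,n!\,\pi^{-3n-6}\qquad(n\ge0\text{ even})$$ is true for $n=0$. -/

import Mathlib

open MeasureTheory Matrix
open scoped TensorProduct ComplexConjugate

noncomputable section

namespace ArchInt

/-! ### Binary forms: the spaces `ℂ[X,Y]_m`, their pairing and the action of `GL₂(ℂ)` -/

/-- Polynomials over `ℂ` in the two variables `X = X 0` and `Y = X 1`.  The space `ℂ[X,Y]_m` is the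
subspace of homogeneous polynomials of degree `m`. -/
abbrev BinPoly : Type := MvPolynomial (Fin 2) ℂ

/-- The monomial `X ^ i * Y ^ j`. -/
def monom (i j : ℕ) : BinPoly := MvPolynomial.X 0 ^ i * MvPolynomial.X 1 ^ j

/-- The coefficient of `X ^ i * Y ^ j`, as a linear form. -/
def coeffXY (i j : ℕ) : BinPoly →ₗ[ℂ] ℂ :=
  MvPolynomial.lcoeff ℂ (Finsupp.single 0 i + Finsupp.single 1 j)

/-- The pairing `⟨·,·⟩_m` on `ℂ[X,Y]_m`, extended by zero to the other degrees:
`⟨X^i Y^(m-i), X^(m-i) Y^i⟩ = (-1)^i * (m choose i)⁻¹`, all other pairs of monomials pair to `0`. -/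
def pairing (m : ℕ) : BinPoly →ₗ[ℂ] BinPoly →ₗ[ℂ] ℂ :=
  ∑ i ∈ Finset.range (m + 1), ((-1 : ℂ) ^ i * ((m.choose i : ℕ) : ℂ)⁻¹) •
    (LinearMap.mul ℂ ℂ).compl₁₂ (coeffXY i (m - i)) (coeffXY (m - i) i)

/-- The dual `(X^i Y^(m-i))^∨` of a monomial with respect to `⟨·,·⟩_m`
(see `pairing_monom_dualMonom`). -/
def dualMonom (m i : ℕ) : BinPoly :=
  ((-1 : ℂ) ^ i * ((m.choose i : ℕ) : ℂ)) • monom (m - i) i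

/-- The action `P(X,Y) ↦ P((X,Y)g) (det g)^b`. -/
def rho (b : ℕ) (g : Matrix (Fin 2) (Fin 2) ℂ) (P : BinPoly) : BinPoly :=
  (g.det ^ b) •
    MvPolynomial.aeval (fun j : Fin 2 => ∑ i : Fin 2, g i j • (MvPolynomial.X i : BinPoly)) P

/-- Complex conjugation on coefficients. -/
def conjPoly : BinPoly →+* BinPoly := MvPolynomial.map (starRingEnd ℂ)

/-- The contraction `⟨Φ, w⟩_m` of the first tensor factor of `Φ` against `w`. -/
def contract (m : ℕ) (Φ : BinPoly ⊗[ℂ] BinPoly) (w : BinPoly) : BinPoly :=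
  TensorProduct.lid ℂ BinPoly (LinearMap.rTensor BinPoly ((pairing m).flip w) Φ)

theorem coeffXY_monom (i j k l : ℕ) :
    coeffXY i j (monom k l) = if i = k ∧ j = l then 1 else 0 := by
  have h : monom k l = MvPolynomial.monomial (Finsupp.single 0 k + Finsupp.single 1 l) (1 : ℂ) := by
    simp only [monom, MvPolynomial.X_pow_eq_monomial, MvPolynomial.monomial_mul, one_mul]
  rw [h]
  simp only [coeffXY, MvPolynomial.lcoeff_apply, MvPolynomial.coeff_monomial]
  congr 1
  rw [eq_iff_iff]
  constructor
  · intro e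
    have h0 := DFunLike.congr_fun e 0
    have h1 := DFunLike.congr_fun e 1
    simp at h0 h1
    exact ⟨h0.symm, h1.symm⟩
  · rintro ⟨rfl, rfl⟩
    rfl

theorem pairing_monom_dualMonom (m i k : ℕ) (hi : i ≤ m) (hk : k ≤ m) :
    pairing m (monom k (m - k)) (dualMonom m i) = if k = i then 1 else 0 := by
  have hc : ((m.choose i : ℕ) : ℂ) ≠ 0 := by
    exact_mod_cast (Nat.choose_pos hi).ne'
  simp only [pairing, LinearMap.sum_apply, LinearMap.smul_apply, LinearMap.compl₁₂_apply,
    LinearMap.mul_apply_apply, dualMonom, map_smul, coeffXY_monom, smul_eq_mul]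
  rw [Finset.sum_eq_single k]
  · by_cases h : k = i
    · subst h
      have h2 : ((-1 : ℂ) ^ k) * (-1) ^ k = 1 := by
        rw [← mul_pow]; norm_num
      simp only [and_self, if_true, mul_one]
      field_simp
      linear_combination h2
    · simp [h]
  · intro b _ hb
    simp [hb]
  · intro h
    exact absurd (Finset.mem_range.mpr (Nat.lt_succ_of_le hk)) h

/-! ### The Bessel function and the Whittaker function -/

/-- The modified Bessel function of the second kind,
`K_s(z) = (1/2) ∫_0^∞ exp(-(z/2)(u + 1/u)) u^(s-1) du` for `Re z > 0`. -/
def besselK (s z : ℂ) : ℂ :=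
  (1 / 2) * ∫ u in Set.Ioi (0 : ℝ),
    Complex.exp (-(z / 2) * ((u : ℂ) + (u : ℂ)⁻¹)) * (u : ℂ) ^ (s - 1)

/-- The value of the Whittaker function at `diag(t, 1)`, `t > 0`:
`2^4 ∑_{j=-n-1}^{n+1} i^j t^(n+2) K_j(4πt) (X^(n+1+j) Y^(n+1-j))^∨`; here `j = k - (n+1)`. -/
def whittakerTorus (n : ℕ) (t : ℝ) : BinPoly :=
  ∑ k ∈ Finset.range (2 * n + 3),
    ((2 : ℂ) ^ 4 * Complex.I ^ ((k : ℤ) - (n + 1)) * (t : ℂ) ^ (n + 2) *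
      besselK ((k : ℂ) - (n + 1)) (4 * Real.pi * t)) • dualMonom (2 * n + 2) k

/-- The squared norm of the bottom row. -/
def rowNormSq (g : Matrix (Fin 2) (Fin 2) ℂ) : ℝ := ‖g 1 0‖ ^ 2 + ‖g 1 1‖ ^ 2

/-- Iwasawa coordinates `g = z * [1, x; 0, 1] * diag(t, 1) * u` of `g ∈ GL₂(ℂ)` with `t > 0`,
`z ∈ ℂˣ` and `u ∈ SU₂` (see `iwasawa_decomposition`); the pair `(z, u)` is unique up to sign. -/
def iwasawaT (g : Matrix (Fin 2) (Fin 2) ℂ) : ℝ := ‖g.det‖ / rowNormSq g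

/-- The unipotent coordinate. -/
def iwasawaX (g : Matrix (Fin 2) (Fin 2) ℂ) : ℂ :=
  (g 0 0 * conj (g 1 0) + g 0 1 * conj (g 1 1)) / rowNormSq g

/-- The central coordinate. -/
def iwasawaZ (g : Matrix (Fin 2) (Fin 2) ℂ) : ℂ :=
  (g.det * rowNormSq g / ‖g.det‖) ^ (1 / 2 : ℂ)

/-- The special unitary coordinate. -/
def iwasawaU (g : Matrix (Fin 2) (Fin 2) ℂ) : Matrix (Fin 2) (Fin 2) ℂ :=
  !![conj (g 1 1 / iwasawaZ g), -conj (g 1 0 / iwasawaZ g);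
     g 1 0 / iwasawaZ g, g 1 1 / iwasawaZ g]

/-- The Whittaker function on `GL₂(ℂ)` with values in `ℂ[X,Y]_(2n+2)`, determined by its values at
`diag(t, 1)`, left equivariance under the character `ψ(x) = exp(2πi(x + x̄))` of the unipotent
radical, invariance under the centre, and `W(g u) = ρ(u⁻¹) W(g)` for `u ∈ SU₂`. -/
def whittaker (n : ℕ) (g : Matrix (Fin 2) (Fin 2) ℂ) : BinPoly :=
  Complex.exp (2 * Real.pi * Complex.I * (iwasawaX g + conj (iwasawaX g))) •
    rho 0 (iwasawaU g)⁻¹ (whittakerTorus n (iwasawaT g))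

/-! ### The quadratic space, the group action and the Schwartz function -/

/-- Coordinates `(p, q, r)` on `V_∞`; `volume` is Lebesgue measure `dRe(p) dIm(p) dq dr`. -/
abbrev VCoord : Type := ℂ × ℝ × ℝ

/-- The element `[p, iq; ir, p̄]` of `V_∞ = {x ∈ M₂(ℂ) | x̄^* = x}` (see `range_vMat`). -/
def vMat (v : VCoord) : Matrix (Fin 2) (Fin 2) ℂ :=
  !![v.1, Complex.I * v.2.1; Complex.I * v.2.2, conj v.1]

/-- The action `x ↦ h x h̄^*`, where `*` is the main involution (the adjugate). -/
def act (h x : Matrix (Fin 2) (Fin 2) ℂ) : Matrix (Fin 2) (Fin 2) ℂ :=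
  h * x * (h.map (starRingEnd ℂ)).adjugate

/-- `𝐩([a, b; b, c]) = a X² + 2b XY + c Y²`. -/
def symToPoly (M : Matrix (Fin 2) (Fin 2) ℂ) : BinPoly :=
  M 0 0 • monom 2 0 + (2 * M 0 1) • monom 1 1 + M 1 1 • monom 0 2

/-- The symmetrization `(x + ᵗx)/2`. -/
def symPart (x : Matrix (Fin 2) (Fin 2) ℂ) : Matrix (Fin 2) (Fin 2) ℂ := (1 / 2 : ℂ) • (x + xᵀ)

/-- The matrix `w₀`. -/
def w₀ : Matrix (Fin 2) (Fin 2) ℂ := !![0, 1; -1, 0]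

/-- The polynomial map `P^α`, with values in `ℂ[X,Y]_(2n+2)`. -/
def polyP (n α : ℕ) (x₁ x₂ : Matrix (Fin 2) (Fin 2) ℂ) : BinPoly :=
  symToPoly (symPart (x₁ * w₀ * x₂)) * symToPoly x₁ ^ α * symToPoly x₂ ^ (n - α)

/-- The Gaussian `exp(-π Tr(x₁ ᵗx̄₁ + x₂ ᵗx̄₂))`. -/
def gaussian (x₁ x₂ : Matrix (Fin 2) (Fin 2) ℂ) : ℂ :=
  Complex.exp (-Real.pi * (x₁ * x₁ᴴ + x₂ * x₂ᴴ).trace)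

/-- The Schwartz function `φ_∞ = ∑_α φ_∞^α ⊗ (n choose α) X^α Y^(n-α)` on `V_∞ ⊕ V_∞`, with values
in `ℂ[X,Y]_(2n+2) ⊗ ℂ[X,Y]_n`. -/
def schwartzPhi (n : ℕ) (x₁ x₂ : Matrix (Fin 2) (Fin 2) ℂ) : BinPoly ⊗[ℂ] BinPoly :=
  ∑ α ∈ Finset.range (n + 1),
    (gaussian x₁ x₂ • polyP n α (symPart x₁) (symPart x₂)) ⊗ₜ[ℂ]
      (((n.choose α : ℕ) : ℂ) • monom α (n - α))

/-! ### The archimedean integral -/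

/-- `diag(t, 1)`. -/
def diagT (t : ℝ) : Matrix (Fin 2) (Fin 2) ℂ := !![(t : ℂ), 0; 0, 1]

/-- `diag(a^(1/2), a^(-1/2))`. -/
def diagA (a : ℝ) : Matrix (Fin 2) (Fin 2) ℂ :=
  !![((Real.sqrt a : ℝ) : ℂ), 0; 0, ((Real.sqrt a)⁻¹ : ℝ)]

/-- `diag(a^(-1/2), a^(1/2))`. -/
def diagAInv (a : ℝ) : Matrix (Fin 2) (Fin 2) ℂ :=
  !![(((Real.sqrt a)⁻¹ : ℝ) : ℂ), 0; 0, (Real.sqrt a : ℝ)]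

/-- The `t`-integrand (including the factor `1/t` of `dt/t`). -/
def integrand (n : ℕ) (a : ℝ) (x : VCoord × VCoord) (t : ℝ) : ℂ :=
  pairing n
    (contract (2 * n + 2)
      (schwartzPhi n (act (diagAInv a) (vMat x.1)) (act (diagAInv a) (vMat x.2)))
      (whittaker n (diagT t * diagA a)))
    (conjPoly (contract (2 * n + 2)
      (schwartzPhi n (vMat x.1) (vMat x.2)) (whittaker n (diagT t)))) / t

/-- The inner integral over `t ∈ (0, ∞)`. -/
def intT (n : ℕ) (a : ℝ) (x : VCoord × VCoord) : ℂ := ∫ t in Set.Ioi (0 : ℝ), integrand n a x t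

/-- The integral over `x ∈ X_∞ = V_∞ ⊕ V_∞`. -/
def intX (n : ℕ) (a : ℝ) : ℂ := ∫ x : VCoord × VCoord, intT n a x

/-- The density `(a - a⁻¹)²/a` times the integral over `x`. -/
def outerIntegrand (n : ℕ) (a : ℝ) : ℂ := (((a - a⁻¹) ^ 2 / a : ℝ) : ℂ) * intX n a

/-- The archimedean integral `I_n`. -/
def archI (n : ℕ) : ℂ := ∫ a in Set.Ioo (0 : ℝ) 1, outerIntegrand n a

/-- All the integrals in the iterated integral `I_n` converge (absolutely). -/
def ArchIConverges (n : ℕ) : Prop :=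
  (∀ a ∈ Set.Ioo (0 : ℝ) 1, ∀ x, IntegrableOn (integrand n a x) (Set.Ioi 0)) ∧
  (∀ a ∈ Set.Ioo (0 : ℝ) 1, Integrable (intT n a)) ∧
  IntegrableOn (outerIntegrand n) (Set.Ioo 0 1)

/-- The conjectural formula for `I_n` (`n` even):
`I_n = (-1)^(n/2) 2^(-4n-8) (n+1)!² n! π^(-3n-6)`. -/
def ArchIFormula (n : ℕ) : Prop :=
  archI n = (-1) ^ (n / 2) * (2 : ℂ) ^ (-(4 * n + 8) : ℤ) * ((n + 1).factorial : ℂ) ^ 2 *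
    (n.factorial : ℂ) * (Real.pi : ℂ) ^ (-(3 * n + 6) : ℤ)

theorem range_vMat :
    Set.range vMat = {x | (x.map (starRingEnd ℂ)).adjugate = x} := by
  ext x
  constructor
  · rintro ⟨v, rfl⟩
    ext i j
    fin_cases i <;> fin_cases j <;> simp [vMat, Matrix.adjugate_fin_two]
  · intro h
    have h01 := congrFun (congrFun h 0) 1
    have h10 := congrFun (congrFun h 1) 0
    have h11 := congrFun (congrFun h 1) 1
    simp [Matrix.adjugate_fin_two] at h01 h10 h11
    refine ⟨(x 0 0, (x 0 1).im, (x 1 0).im), ?_⟩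
    have e01 : (x 0 1).re = 0 := by
      have := congrArg Complex.re h01
      simp at this
      linarith
    have e10 : (x 1 0).re = 0 := by
      have := congrArg Complex.re h10
      simp at this
      linarith
    ext i j
    fin_cases i <;> fin_cases j <;> simp [vMat, h11, Complex.ext_iff, e01, e10]

theorem rowNormSq_pos (g : Matrix (Fin 2) (Fin 2) ℂ) (hg : g.det ≠ 0) : 0 < rowNormSq g := by
  unfold rowNormSq
  by_contra hcon
  have h0 : ‖g 1 0‖ ^ 2 = 0 := by nlinarith [sq_nonneg ‖g 1 0‖, sq_nonneg ‖g 1 1‖]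
  have h1 : ‖g 1 1‖ ^ 2 = 0 := by nlinarith [sq_nonneg ‖g 1 0‖, sq_nonneg ‖g 1 1‖]
  apply hg
  rw [Matrix.det_fin_two]
  simp at h0 h1
  simp [h0, h1]

theorem iwasawaZ_sq (g : Matrix (Fin 2) (Fin 2) ℂ) :
    iwasawaZ g ^ 2 = g.det * rowNormSq g / ‖g.det‖ := by
  unfold iwasawaZ
  rw [← Complex.cpow_nat_mul]
  norm_num

theorem iwasawaZ_mul_conj (g : Matrix (Fin 2) (Fin 2) ℂ) (hg : g.det ≠ 0) :
    iwasawaZ g * conj (iwasawaZ g) = rowNormSq g := by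
  have hN := rowNormSq_pos g hg
  have h := congrArg norm (iwasawaZ_sq g)
  rw [norm_pow, norm_div, norm_mul, Complex.norm_real, Complex.norm_real, norm_norm,
    Real.norm_of_nonneg hN.le, mul_div_cancel_left₀ _ (norm_ne_zero_iff.mpr hg)] at h
  rw [Complex.mul_conj, Complex.normSq_eq_norm_sq, h]

theorem rowNormSq_eq (g : Matrix (Fin 2) (Fin 2) ℂ) :
    (rowNormSq g : ℂ) = g 1 0 * conj (g 1 0) + g 1 1 * conj (g 1 1) := by
  rw [Complex.mul_conj, Complex.mul_conj, Complex.normSq_eq_norm_sq, Complex.normSq_eq_norm_sq]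
  simp [rowNormSq]

theorem iwasawa_decomposition (g : Matrix (Fin 2) (Fin 2) ℂ) (hg : g.det ≠ 0) :
    0 < iwasawaT g ∧ iwasawaZ g ≠ 0 ∧ iwasawaU g ∈ Matrix.specialUnitaryGroup (Fin 2) ℂ ∧
    g = iwasawaZ g • (!![1, iwasawaX g; 0, 1] * diagT (iwasawaT g) * iwasawaU g) := by
  have hN := rowNormSq_pos g hg
  have hNC : (rowNormSq g : ℂ) ≠ 0 := by exact_mod_cast hN.ne'
  have hD : (‖g.det‖ : ℂ) ≠ 0 := by exact_mod_cast norm_ne_zero_iff.mpr hg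
  have hzz := iwasawaZ_mul_conj g hg
  have hz2 := iwasawaZ_sq g
  have hNe := rowNormSq_eq g
  have hz : iwasawaZ g ≠ 0 := by
    intro h0
    rw [h0, zero_mul] at hzz
    exact hNC hzz.symm
  have hzc : conj (iwasawaZ g) ≠ 0 := by simpa using hz
  refine ⟨div_pos (norm_pos_iff.mpr hg) hN, hz, ?_, ?_⟩
  · have key : g 1 0 / iwasawaZ g * conj (g 1 0 / iwasawaZ g) +
        g 1 1 / iwasawaZ g * conj (g 1 1 / iwasawaZ g) = 1 := by
      rw [map_div₀, map_div₀, div_mul_div_comm, div_mul_div_comm, ← add_div, hzz, ← hNe,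
        div_self hNC]
    rw [Matrix.mem_specialUnitaryGroup_iff, Matrix.mem_unitaryGroup_iff]
    constructor
    · ext i j
      fin_cases i <;> fin_cases j <;>
        simp only [iwasawaU, Matrix.star_eq_conjTranspose, Matrix.mul_apply, Fin.sum_univ_two,
          Matrix.conjTranspose_apply, Matrix.one_apply, Matrix.of_apply, Matrix.cons_val',
          Matrix.cons_val_zero, Matrix.cons_val_one, Matrix.cons_val_fin_one, Fin.zero_eta,
          Fin.mk_one, Fin.isValue, RCLike.star_def, map_neg, Complex.conj_conj, if_true,
          zero_ne_one, one_ne_zero, if_false] <;>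
        first | linear_combination key | ring
    · rw [Matrix.det_fin_two]
      simp only [iwasawaU, Matrix.of_apply, Matrix.cons_val', Matrix.cons_val_zero,
          Matrix.cons_val_one, Matrix.cons_val_fin_one]
      linear_combination key
  · have hq : iwasawaZ g / conj (iwasawaZ g) = g.det / ‖g.det‖ := by
      rw [div_eq_div_iff hzc hD]
      apply mul_left_cancel₀ hz
      have e : iwasawaZ g ^ 2 * ‖g.det‖ = g.det * rowNormSq g := by
        rw [hz2, div_mul_cancel₀ _ hD]
      linear_combination e - g.det * hzz
    have ht : (iwasawaT g : ℂ) * (iwasawaZ g / conj (iwasawaZ g)) = g.det / rowNormSq g := by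
      rw [hq, iwasawaT]
      push_cast
      field_simp
    have hx : iwasawaX g * rowNormSq g = g 0 0 * conj (g 1 0) + g 0 1 * conj (g 1 1) := by
      rw [iwasawaX, div_mul_cancel₀ _ hNC]
    have ht' : (iwasawaT g : ℂ) * (iwasawaZ g / conj (iwasawaZ g)) * rowNormSq g =
        g 0 0 * g 1 1 - g 0 1 * g 1 0 := by
      rw [ht, div_mul_cancel₀ _ hNC, Matrix.det_fin_two]
    ext i j
    fin_cases i <;> fin_cases j <;>
      simp [diagT, iwasawaU, Matrix.mul_apply]
    · apply mul_right_cancel₀ hNC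
      have e : iwasawaZ g * (iwasawaT g * (conj (g 1 1) / conj (iwasawaZ g)) +
          iwasawaX g * (g 1 0 / iwasawaZ g)) =
          iwasawaT g * (iwasawaZ g / conj (iwasawaZ g)) * conj (g 1 1) + iwasawaX g * g 1 0 := by
        field_simp
      rw [e]
      linear_combination g 0 0 * hNe - conj (g 1 1) * ht' - g 1 0 * hx
    · apply mul_right_cancel₀ hNC
      have e : iwasawaZ g * (-(iwasawaT g * (conj (g 1 0) / conj (iwasawaZ g))) +
          iwasawaX g * (g 1 1 / iwasawaZ g)) =
          -(iwasawaT g * (iwasawaZ g / conj (iwasawaZ g)) * conj (g 1 0)) +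
            iwasawaX g * g 1 1 := by
        field_simp
      rw [e]
      linear_combination g 0 1 * hNe + conj (g 1 0) * ht' - g 1 1 * hx
    · field_simp
    · field_simp

end ArchInt

end

noncomputable section

namespace ArchInt

/-! For `n = 0` both contractions are scalars, and the diagonal matrices meet `W_0` only through
`W_0(diag(t, 1))` and `W_0(diag(ta, 1))`. Each scalar is a Gaussian times `32 t² (i·imCross·K₀ -
reCross·K₁)`, with `ta` and `reCrossA` in the twisted factor. So the integrand is a sum of four
products of a quartic polynomial in `x`, a Gaussian in `x` and a moment density `t³ K_i(4πta)
K_j(4πt)` (`integrand_zero`).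

The reflection `Im p ↦ -Im p` kills the mixed terms in the integral over `x`, so the moments of
`K₀K₁` need only be finite. The other two Gaussian averages are explicit (`hasInt_imCross_sq`,
`hasInt_reCross_mul_reCrossA`). The moments of `K₀K₀` and `K₁K₁` become integrals of rational
functions after inserting the integral representation and applying Tonelli
(`lintegral_kBessel_mul`), and are combinations of `1` and `log a`. In the weighted sum the rational
parts cancel (`outerIntegrand_zero`), and what remains has an elementary primitive on `(0, 1)`
(`hasDerivAt_outerPrim`). -/

/-! ### The Whittaker function on positive diagonal matrices. -/

theorem rho_zero_one (P : BinPoly) : rho 0 1 P = P := by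
  have h : (fun j : Fin 2 => ∑ i : Fin 2, (1 : Matrix (Fin 2) (Fin 2) ℂ) i j •
      (MvPolynomial.X i : BinPoly)) = MvPolynomial.X := by
    funext j
    fin_cases j <;> simp [Matrix.one_apply]
  rw [rho, h]
  simp

theorem whittaker_of_diagonal (n : ℕ) (x y : ℝ) (hx : 0 < x) (hy : 0 < y) :
    whittaker n !![(x : ℂ), 0; 0, (y : ℂ)] = whittakerTorus n (x / y) := by
  have hN : rowNormSq !![(x : ℂ), 0; 0, (y : ℂ)] = y ^ 2 := by
    simp [rowNormSq]
  have hdet : (!![(x : ℂ), 0; 0, (y : ℂ)]).det = ((x * y : ℝ) : ℂ) := by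
    simp [Matrix.det_fin_two]
  have hxy : ‖((x * y : ℝ) : ℂ)‖ = x * y := by
    rw [Complex.norm_real, Real.norm_of_nonneg (by positivity)]
  have hT : iwasawaT !![(x : ℂ), 0; 0, (y : ℂ)] = x / y := by
    rw [iwasawaT, hN, hdet, hxy]
    field_simp
  have hX : iwasawaX !![(x : ℂ), 0; 0, (y : ℂ)] = 0 := by
    simp [iwasawaX]
  -- The central coordinate is a principal square root of `y²`; positivity selects `y` rather than
  -- `-y`, which makes the unitary part exactly `1`.
  have hZ : iwasawaZ !![(x : ℂ), 0; 0, (y : ℂ)] = y := by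
    have h : ((x * y : ℝ) : ℂ) * ((y ^ 2 : ℝ) : ℂ) / ((x * y : ℝ) : ℂ) = ((y ^ 2 : ℝ) : ℂ) := by
      have : ((x * y : ℝ) : ℂ) ≠ 0 := by exact_mod_cast (mul_pos hx hy).ne'
      field_simp
    rw [iwasawaZ, hN, hdet, hxy, h]
    rw [show (1 / 2 : ℂ) = ((1 / 2 : ℝ) : ℂ) by push_cast; rfl,
      ← Complex.ofReal_cpow (by positivity), ← Real.sqrt_eq_rpow, Real.sqrt_sq hy.le]
  have hU : iwasawaU !![(x : ℂ), 0; 0, (y : ℂ)] = 1 := by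
    have hy' : (y : ℂ) ≠ 0 := by exact_mod_cast hy.ne'
    ext i j
    fin_cases i <;> fin_cases j <;> simp [iwasawaU, hZ, hy']
  rw [whittaker, hX, hU, hT, inv_one, rho_zero_one]
  simp

theorem whittaker_diagT (n : ℕ) (t : ℝ) (ht : 0 < t) :
    whittaker n (diagT t) = whittakerTorus n t := by
  have := whittaker_of_diagonal n t 1 ht one_pos
  simpa [diagT] using this

/-- The product is the scalar `a^(-1/2)` times `diag(ta, 1)`, and the centre acts trivially. -/
theorem whittaker_diagT_mul_diagA (n : ℕ) (t a : ℝ) (ht : 0 < t) (ha : 0 < a) :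
    whittaker n (diagT t * diagA a) = whittakerTorus n (t * a) := by
  have hs : 0 < Real.sqrt a := Real.sqrt_pos.mpr ha
  have h := whittaker_of_diagonal n (t * Real.sqrt a) (Real.sqrt a)⁻¹ (by positivity)
    (by positivity)
  have e : t * Real.sqrt a / (Real.sqrt a)⁻¹ = t * a := by
    rw [div_inv_eq_mul, mul_assoc, Real.mul_self_sqrt ha.le]
  rw [e] at h
  rw [← h]
  congr 1
  ext i j
  fin_cases i <;> fin_cases j <;> simp [diagT, diagA, Matrix.mul_apply]

/-! ### The contractions for `n = 0` in coordinates. -/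

/-- Dual monomials read off the coefficients of the quadratic form; the minus sign on the `Y²` term
is `i⁻¹ = -i`. -/
theorem pairing_symToPoly_whittakerTorus (M : Matrix (Fin 2) (Fin 2) ℂ) (t : ℝ) :
    pairing 2 (symToPoly M) (whittakerTorus 0 t) = 16 * (t : ℂ) ^ 2 *
      (2 * M 0 1 * besselK 0 (4 * Real.pi * t) + Complex.I *
        (besselK 1 (4 * Real.pi * t) * M 0 0 - besselK (-1) (4 * Real.pi * t) * M 1 1)) := by
  have p (k i : ℕ) (hk : k ≤ 2) (hi : i ≤ 2) :
      pairing 2 (monom k (2 - k)) (dualMonom 2 i) = if k = i then 1 else 0 :=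
    pairing_monom_dualMonom 2 i k hi hk
  have p2 (i : ℕ) (hi : i ≤ 2) := p 2 i le_rfl hi
  have p1 (i : ℕ) (hi : i ≤ 2) := p 1 i one_le_two hi
  have p0 (i : ℕ) (hi : i ≤ 2) := p 0 i zero_le_two hi
  norm_num at p0 p1 p2
  simp only [symToPoly, whittakerTorus, Finset.sum_range_succ, Finset.sum_range_zero, map_add,
    map_smul, LinearMap.add_apply, LinearMap.smul_apply, smul_eq_mul, zero_add, mul_zero]
  simp only [p0, p1, p2, one_le_two, zero_le_two, le_refl]
  norm_num
  ring

theorem contract_tmul (m : ℕ) (A B w : BinPoly) :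
    contract m (A ⊗ₜ[ℂ] B) w = pairing m A w • B := by
  simp [contract]

theorem pairing_zero_smul_one (c d : ℂ) :
    pairing 0 (c • monom 0 0) (conjPoly (d • monom 0 0)) = c * conj d := by
  have h : conjPoly (d • monom 0 0) = conj d • monom 0 0 := by
    simp [conjPoly, monom, MvPolynomial.smul_eq_C_mul]
  rw [h]
  simp [pairing, coeffXY_monom, mul_comm]

/-- The contraction of `schwartzPhi 0` against the Whittaker function is a scalar. -/
theorem contract_schwartzPhi_zero (x₁ x₂ : Matrix (Fin 2) (Fin 2) ℂ) (w : BinPoly) :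
    contract 2 (schwartzPhi 0 x₁ x₂) w = (gaussian x₁ x₂ *
      pairing 2 (symToPoly (symPart (symPart x₁ * w₀ * symPart x₂))) w) • monom 0 0 := by
  have : schwartzPhi 0 x₁ x₂ = (gaussian x₁ x₂ • polyP 0 0 (symPart x₁) (symPart x₂)) ⊗ₜ[ℂ]
      monom 0 0 := by
    simp [schwartzPhi]
  rw [this, contract_tmul]
  simp [polyP]

theorem act_diagAInv_vMat (a : ℝ) (ha : 0 < a) (v : VCoord) :
    act (diagAInv a) (vMat v) = vMat (v.1, v.2.1 / a, a * v.2.2) := by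
  have hs : Real.sqrt a ≠ 0 := (Real.sqrt_pos.mpr ha).ne'
  have hs' : ((Real.sqrt a : ℝ) : ℂ) ≠ 0 := by exact_mod_cast hs
  have hsq : ((Real.sqrt a : ℝ) : ℂ) ^ 2 = a := by
    exact_mod_cast Real.sq_sqrt ha.le
  have ha' : (a : ℂ) ≠ 0 := by exact_mod_cast ha.ne'
  ext i j
  fin_cases i <;> fin_cases j <;>
    simp [act, diagAInv, vMat, Matrix.mul_apply, Matrix.adjugate_fin_two, ← hsq] <;>
    field_simp

theorem gaussian_vMat (v w : VCoord) :
    gaussian (vMat v) (vMat w) = ((Real.exp (-Real.pi *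
      (2 * v.1.re ^ 2 + 2 * v.1.im ^ 2 + v.2.1 ^ 2 + v.2.2 ^ 2 +
        (2 * w.1.re ^ 2 + 2 * w.1.im ^ 2 + w.2.1 ^ 2 + w.2.2 ^ 2))) : ℝ) : ℂ) := by
  have h (z : ℂ) : z * conj z = (z.re : ℂ) ^ 2 + (z.im : ℂ) ^ 2 := by
    rw [Complex.mul_conj, Complex.normSq_apply]; push_cast; ring
  rw [gaussian, Complex.ofReal_exp]
  congr 1
  simp only [vMat, Matrix.trace_fin_two, Matrix.add_apply, Matrix.mul_apply, Fin.sum_univ_two,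
    Matrix.conjTranspose_apply, Matrix.of_apply, Matrix.cons_val', Matrix.cons_val_zero,
    Matrix.cons_val_one, Matrix.cons_val_fin_one, RCLike.star_def, Complex.conj_conj, map_mul,
    Complex.conj_I, Complex.conj_ofReal]
  push_cast
  linear_combination (-2 * (Real.pi : ℂ)) * (h v.1 + h w.1) + (Real.pi : ℂ) *
    ((v.2.1 : ℂ) ^ 2 + (v.2.2 : ℂ) ^ 2 + (w.2.1 : ℂ) ^ 2 + (w.2.2 : ℂ) ^ 2) * Complex.I_sq

/-- The half sum `(q + r) / 2` of the off-diagonal coordinates. -/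
def offHalf (v : VCoord) : ℝ := (v.2.1 + v.2.2) / 2

/-- Write `S`, `T` for the symmetric parts. The transpose of `S w₀ T` is `-T w₀ S`, so its
symmetrization is alternating in the two vectors, and its entries are built from 2×2 minors of the
coordinates `p`, `p̄` and `offHalf`. -/
theorem pairing_vMat_whittakerTorus (v w : VCoord) (t : ℝ) :
    pairing 2 (symToPoly (symPart (symPart (vMat v) * w₀ * symPart (vMat w))))
      (whittakerTorus 0 t) = 16 * (t : ℂ) ^ 2 *
      (2 * Complex.I * ((v.1.im * w.1.re - v.1.re * w.1.im : ℝ) : ℂ) *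
          besselK 0 (4 * Real.pi * t) -
        (besselK 1 (4 * Real.pi * t) * (v.1 * offHalf w - w.1 * offHalf v) +
          besselK (-1) (4 * Real.pi * t) * (conj v.1 * offHalf w - conj w.1 * offHalf v))) := by
  rw [pairing_symToPoly_whittakerTorus]
  have hv : v.1 = v.1.re + v.1.im * Complex.I := (Complex.re_add_im _).symm
  have hw : w.1 = w.1.re + w.1.im * Complex.I := (Complex.re_add_im _).symm
  have hv' : conj v.1 = v.1.re - v.1.im * Complex.I := by
    simp [Complex.ext_iff]
  have hw' : conj w.1 = w.1.re - w.1.im * Complex.I := by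
    simp [Complex.ext_iff]
  simp only [symPart, vMat, w₀, offHalf, Matrix.mul_apply, Fin.sum_univ_two, Matrix.smul_apply,
    Matrix.add_apply, Matrix.transpose_apply, Matrix.of_apply, Matrix.cons_val', smul_eq_mul,
    Matrix.cons_val_zero, Matrix.cons_val_one, Matrix.cons_val_fin_one, hv', hw']
  rw [hv, hw]
  simp only [Complex.add_re, Complex.add_im, Complex.mul_re, Complex.mul_im, Complex.ofReal_re,
    Complex.ofReal_im, Complex.I_re, Complex.I_im]
  push_cast
  ring_nf
  simp only [Complex.I_sq, Complex.I_pow_three]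
  ring_nf

/-! ### Bessel functions of order `-1`, `0`, `1` at positive arguments. -/

/-- The integrand of the real Bessel function `kBessel`. -/
def kKernel (j : ℤ) (x u : ℝ) : ℝ := 1 / 2 * (Real.exp (-(x / 2) * (u + u⁻¹)) * u ^ (j - 1))

/-- The modified Bessel function of integral order at real arguments. -/
def kBessel (j : ℤ) (x : ℝ) : ℝ := ∫ u in Set.Ioi (0 : ℝ), kKernel j x u

theorem besselK_ofReal (j : ℤ) (x : ℝ) : besselK (j : ℂ) (x : ℂ) = (kBessel j x : ℂ) := by
  rw [besselK, kBessel, ← integral_complex_ofReal, ← integral_const_mul]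
  refine integral_congr_ae (Filter.Eventually.of_forall fun u => ?_)
  have h : (j : ℂ) - 1 = ((j - 1 : ℤ) : ℂ) := by push_cast; rfl
  simp only [kKernel]
  rw [h, Complex.cpow_intCast]
  push_cast
  rfl

theorem kKernel_nonneg (j : ℤ) (x : ℝ) {u : ℝ} (hu : 0 ≤ u) : 0 ≤ kKernel j x u := by
  unfold kKernel; positivity

theorem kBessel_nonneg (j : ℤ) (x : ℝ) : 0 ≤ kBessel j x :=
  setIntegral_nonneg measurableSet_Ioi fun _ hu => kKernel_nonneg j x (le_of_lt hu)

/-- Substitute `u ↦ u⁻¹`. -/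
theorem kBessel_neg (j : ℤ) (x : ℝ) : kBessel (-j) x = kBessel j x := by
  rw [kBessel, kBessel, ← integral_comp_rpow_Ioi (kKernel j x) (by norm_num : (-1 : ℝ) ≠ 0)]
  refine setIntegral_congr_fun measurableSet_Ioi fun u hu => ?_
  have hu : 0 < u := hu
  simp only [kKernel]
  have e : u ^ (-1 - 1 : ℝ) = u ^ (-2 : ℤ) := by rw [← Real.rpow_intCast]; norm_num
  rw [e, Real.rpow_neg_one, inv_inv, smul_eq_mul, _root_.inv_zpow', add_comm u⁻¹ u]
  have : u ^ (-j - 1) = u ^ (-2 : ℤ) * u ^ (-(j - 1)) := by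
    rw [← zpow_add₀ hu.ne']; congr 1; ring
  rw [this]
  norm_num
  ring

theorem measurable_kKernel (j : ℤ) : Measurable fun p : ℝ × ℝ => kKernel j p.1 p.2 := by
  unfold kKernel
  fun_prop

theorem measurable_kBessel (j : ℤ) : Measurable (kBessel j) := by
  have := (measurable_kKernel j).stronglyMeasurable.integral_prod_right'
    (ν := volume.restrict (Set.Ioi (0 : ℝ)))
  exact this.measurable

/-- The factor `exp(-y/u)` absorbs the pole of `u^(j-1)` at `0`. The bound is uniform in `u`, so the
remaining factor `exp(-yu)` of the kernel gives integrability. -/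
theorem zpow_mul_exp_neg_inv_le (j : ℤ) (hj : |j| ≤ 1) (y : ℝ) (hy : 0 < y) (u : ℝ) (hu : 0 < u) :
    Real.exp (-(y * u⁻¹)) * u ^ (j - 1) ≤ 1 + 1 / y + 2 / y ^ 2 := by
  set z := y * u⁻¹ with hz
  have hz0 : 0 < z := by positivity
  have hu' : u = y / z := by rw [hz]; field_simp
  have h2 : z ^ 2 / 2 ≤ Real.exp z := by
    have := Real.quadratic_le_exp_of_nonneg hz0.le
    linarith
  have h1 : z ≤ Real.exp z := by linarith [Real.add_one_le_exp z]
  have h0 : 1 ≤ Real.exp z := Real.one_le_exp hz0.le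
  have hE := Real.exp_pos z
  rw [Real.exp_neg]
  have hj' : j = -1 ∨ j = 0 ∨ j = 1 := by
    rw [abs_le] at hj; omega
  have p1 : 0 < 1 / y := by positivity
  have p2 : 0 < 2 / y ^ 2 := by positivity
  rcases hj' with rfl | rfl | rfl
  · have : (Real.exp z)⁻¹ * u ^ (-1 - 1 : ℤ) = 2 / y ^ 2 * ((z ^ 2 / 2) / Real.exp z) := by
      rw [hu', show (-1 - 1 : ℤ) = -(2 : ℕ) by norm_num, _root_.zpow_neg, zpow_natCast]
      field_simp
    rw [this]
    have : (z ^ 2 / 2) / Real.exp z ≤ 1 := by rwa [div_le_one hE]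
    nlinarith
  · have : (Real.exp z)⁻¹ * u ^ (0 - 1 : ℤ) = 1 / y * (z / Real.exp z) := by
      rw [hu', show (0 - 1 : ℤ) = -(1 : ℕ) by norm_num, _root_.zpow_neg, zpow_natCast]
      field_simp
    rw [this]
    have : z / Real.exp z ≤ 1 := by rwa [div_le_one hE]
    nlinarith
  · have : (Real.exp z)⁻¹ ≤ 1 := inv_le_one_of_one_le₀ h0
    rw [sub_self, zpow_zero, mul_one]
    linarith

theorem integrableOn_kKernel (j : ℤ) (hj : |j| ≤ 1) (x : ℝ) (hx : 0 < x) :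
    IntegrableOn (kKernel j x) (Set.Ioi 0) := by
  have hexp : IntegrableOn (fun u : ℝ => Real.exp (-(x / 2) * u)) (Set.Ioi 0) :=
    integrableOn_exp_mul_Ioi (by linarith) 0
  refine Integrable.mono' (hexp.const_mul (1 / 2 * (1 + 1 / (x / 2) + 2 / (x / 2) ^ 2))) ?_ ?_
  · exact ((measurable_kKernel j).comp measurable_prodMk_left).aestronglyMeasurable
  · refine (ae_restrict_iff' measurableSet_Ioi).mpr (Filter.Eventually.of_forall fun u hu => ?_)
    have hu : 0 < u := hu
    rw [Real.norm_of_nonneg (kKernel_nonneg j x hu.le), kKernel]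
    have h := zpow_mul_exp_neg_inv_le j hj (x / 2) (by positivity) u hu
    have e : Real.exp (-(x / 2) * (u + u⁻¹)) =
        Real.exp (-(x / 2) * u) * Real.exp (-(x / 2 * u⁻¹)) := by
      rw [← Real.exp_add]; ring_nf
    rw [e]
    have := mul_le_mul_of_nonneg_left h (Real.exp_pos (-(x / 2) * u)).le
    nlinarith

theorem ofReal_kBessel (j : ℤ) (hj : |j| ≤ 1) (x : ℝ) (hx : 0 < x) :
    ENNReal.ofReal (kBessel j x) = ∫⁻ u in Set.Ioi 0, ENNReal.ofReal (kKernel j x u) := by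
  rw [kBessel, ofReal_integral_eq_lintegral_ofReal (integrableOn_kKernel j hj x hx)]
  exact (ae_restrict_iff' measurableSet_Ioi).mpr
    (Filter.Eventually.of_forall fun u hu => kKernel_nonneg j x (le_of_lt hu))

/-- Since `K₁ = K₋₁`, it suffices to compare `2K₀` with `K₁ + K₋₁`; the difference of the kernels is
a positive multiple of the square `(1 - u⁻¹)²`. -/
theorem kBessel_zero_le_one (x : ℝ) (hx : 0 < x) : kBessel 0 x ≤ kBessel 1 x := by
  have hi := fun j hj => integrableOn_kKernel j hj x hx
  have h : kBessel 0 x ≤ (kBessel 1 x + kBessel (-1) x) / 2 := by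
    rw [kBessel, kBessel, kBessel, ← integral_add (hi 1 (by norm_num)) (hi (-1) (by norm_num)),
      ← integral_div]
    refine setIntegral_mono_on (hi 0 (by norm_num))
      (((hi 1 (by norm_num)).add (hi (-1) (by norm_num))).div_const 2) measurableSet_Ioi ?_
    intro u hu
    have hu : 0 < u := hu
    have e : kKernel 1 x u + kKernel (-1) x u - 2 * kKernel 0 x u =
        1 / 2 * Real.exp (-(x / 2) * (u + u⁻¹)) * (1 - u⁻¹) ^ 2 := by
      simp only [kKernel]
      rw [show (-1 - 1 : ℤ) = -(2 : ℕ) by norm_num, show (0 - 1 : ℤ) = -(1 : ℕ) by norm_num,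
        _root_.zpow_neg, zpow_natCast, _root_.zpow_neg, zpow_natCast]
      norm_num
      ring
    have : 0 ≤ 1 / 2 * Real.exp (-(x / 2) * (u + u⁻¹)) * (1 - u⁻¹) ^ 2 := by positivity
    linarith
  rw [kBessel_neg] at h
  linarith

/-! ### Elementary integrals over the half-line. -/

/-- A nonnegative derivative of a function with a finite limit is automatically integrable, so a
primitive yields the extended nonnegative integral with no separate estimate. -/
theorem lintegral_Ioi_ofReal_deriv {g g' : ℝ → ℝ} {l c : ℝ}
    (hderiv : ∀ x ∈ Set.Ici (0 : ℝ), HasDerivAt g (g' x) x) (hpos : ∀ x ∈ Set.Ioi (0 : ℝ), 0 ≤ g' x)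
    (hlim : Filter.Tendsto g Filter.atTop (nhds l)) (hc : l - g 0 = c) :
    0 ≤ c ∧ ∫⁻ x in Set.Ioi 0, ENNReal.ofReal (g' x) = ENNReal.ofReal c := by
  rw [← hc, ← integral_Ioi_of_hasDerivAt_of_nonneg' hderiv hpos hlim,
    ofReal_integral_eq_lintegral_ofReal (integrableOn_Ioi_deriv_of_nonneg' hderiv hpos hlim)]
  · exact ⟨setIntegral_nonneg measurableSet_Ioi hpos, rfl⟩
  · exact (ae_restrict_iff' measurableSet_Ioi).mpr (Filter.Eventually.of_forall hpos)

theorem lintegral_Ioi_comp_mul_left (u : ℝ) (hu : 0 < u) (g : ℝ → ENNReal) :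
    ∫⁻ v in Set.Ioi 0, g v = ∫⁻ m in Set.Ioi 0, ENNReal.ofReal u * g (u * m) := by
  have h := lintegral_image_eq_lintegral_abs_deriv_mul (f := fun m => u * m) (f' := fun _ => u)
    (s := Set.Ioi 0) measurableSet_Ioi
    (fun m _ => by simpa using ((hasDerivAt_id m).const_mul u).hasDerivWithinAt)
    (fun x _ y _ hxy => mul_left_cancel₀ hu.ne' hxy) g
  have e : (fun m => u * m) '' Set.Ioi 0 = Set.Ioi 0 := by
    simpa using Set.image_mul_left_Ioi hu 0
  rw [e, abs_of_pos hu] at h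
  exact h

theorem lintegral_pow_three_mul_exp (c S : ℝ) (hc : 0 ≤ c) (hS : 0 < S) :
    ∫⁻ t in Set.Ioi 0, ENNReal.ofReal (c * (t ^ 3 * Real.exp (-(S * t)))) =
      ENNReal.ofReal (c * (6 / S ^ 4)) := by
  have hi : IntegrableOn (fun t : ℝ => t ^ 3 * Real.exp (-(S * t))) (Set.Ioi 0) := by
    have := integrableOn_rpow_mul_exp_neg_mul_rpow (p := 1) (s := 3) (b := S) (by norm_num)
      (by norm_num) hS
    refine this.congr_fun (fun t _ => ?_) measurableSet_Ioi
    simp only [Real.rpow_one, neg_mul]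
    norm_cast
  have hv : ∫ t in Set.Ioi (0 : ℝ), t ^ 3 * Real.exp (-(S * t)) = 6 / S ^ 4 := by
    have := Real.integral_rpow_mul_exp_neg_mul_Ioi (a := 4) (r := S) (by norm_num) hS
    rw [show (4 : ℝ) = (3 : ℕ) + 1 by norm_num, Real.Gamma_nat_eq_factorial] at this
    rw [show ((3 : ℕ) + 1 : ℝ) = ((4 : ℕ) : ℝ) by norm_num, Real.rpow_natCast] at this
    norm_num [Nat.factorial] at this
    rw [show (6 : ℝ) / S ^ 4 = (S ^ 4)⁻¹ * 6 by ring, ← this]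
  rw [← hv, ← integral_const_mul, ofReal_integral_eq_lintegral_ofReal (hi.const_mul c)]
  exact (ae_restrict_iff' measurableSet_Ioi).mpr (Filter.Eventually.of_forall fun t ht => by
    have : 0 < t := ht
    positivity)

theorem lintegral_rational (c A B : ℝ) (hc : 0 ≤ c) (hA : 0 < A) (hB : 0 < B) :
    ∫⁻ u in Set.Ioi 0, ENNReal.ofReal (c * (u ^ 3 / (A * u ^ 2 + B) ^ 4)) =
      ENNReal.ofReal (c * (1 / (12 * A ^ 2 * B ^ 2))) := by
  refine (lintegral_Ioi_ofReal_deriv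
    -- With `y = Au² + B` one has `u³ du = (y - B) dy / (2A²)`; this is the primitive of `(y -
    -- B)/y⁴`.
    (g := fun u => c * (1 / (2 * A ^ 2) * (-(1 / 2) * ((A * u ^ 2 + B) ^ 2)⁻¹ +
      B / 3 * ((A * u ^ 2 + B) ^ 3)⁻¹)))
    (g' := fun u => c * (u ^ 3 / (A * u ^ 2 + B) ^ 4)) (l := 0) ?_ ?_ ?_ ?_).2
  · intro u _
    have hy : 0 < A * u ^ 2 + B := by positivity
    have h0 : HasDerivAt (fun u : ℝ => A * u ^ 2 + B) (A * (2 * u)) u := by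
      simpa using ((hasDerivAt_pow 2 u).const_mul A).add_const B
    have h2 := (h0.pow 2).inv (pow_ne_zero 2 hy.ne')
    have h3 := (h0.pow 3).inv (pow_ne_zero 3 hy.ne')
    have := (((h2.const_mul (-(1 / 2))).add (h3.const_mul (B / 3))).const_mul
      (1 / (2 * A ^ 2))).const_mul c
    refine this.congr_deriv ?_
    simp only [Pi.pow_apply]
    field_simp
    ring
  · intro u hu
    have : 0 < u := hu
    positivity
  · have h0 : Filter.Tendsto (fun u : ℝ => A * u ^ 2 + B) Filter.atTop Filter.atTop :=
      Filter.tendsto_atTop_add_const_right _ _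
        ((Filter.tendsto_pow_atTop two_ne_zero).const_mul_atTop hA)
    have h2 := ((Filter.tendsto_pow_atTop two_ne_zero).comp h0).inv_tendsto_atTop
    have h3 := ((Filter.tendsto_pow_atTop three_ne_zero).comp h0).inv_tendsto_atTop
    have := (((h2.const_mul (-(1 / 2))).add (h3.const_mul (B / 3))).const_mul
      (1 / (2 * A ^ 2))).const_mul c
    simpa using this
  · field_simp
    ring

/-! ### Moments of products of two Bessel functions. -/

/-- The second Bessel variable is replaced by `v = um`. Pairing order `j` with order `-j` makes the
total power of `u` equal to `u⁻¹` for every `j`, leaving `j` only in the power of `m`. -/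
theorem ofReal_pow_three_mul_kBessel (j : ℤ) (hj : |j| ≤ 1) (a : ℝ) (ha : 0 < a) (t : ℝ)
    (ht : 0 < t) :
    ENNReal.ofReal (t ^ 3 * (kBessel j (4 * Real.pi * (t * a)) * kBessel (-j) (4 * Real.pi * t))) =
    ∫⁻ u in Set.Ioi (0 : ℝ), ∫⁻ m in Set.Ioi (0 : ℝ),
      ENNReal.ofReal (1 / 4 * (u⁻¹ * m ^ (-j - 1)) * (t ^ 3 *
        Real.exp (-(2 * Real.pi * ((a + m) * u + (a + m⁻¹) * u⁻¹) * t)))) := by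
  have hpi := Real.pi_pos
  have h1 := kBessel_nonneg j (4 * Real.pi * (t * a))
  have hj' : |(-j)| ≤ 1 := by rwa [abs_neg]
  have hm (i : ℤ) (x : ℝ) : Measurable fun u => ENNReal.ofReal (kKernel i x u) :=
    ((measurable_kKernel i).comp measurable_prodMk_left).ennreal_ofReal
  rw [ENNReal.ofReal_mul (by positivity), ENNReal.ofReal_mul h1,
    ofReal_kBessel j hj _ (by positivity), ofReal_kBessel (-j) hj' _ (by positivity),
    ← lintegral_mul_const _ (hm _ _), ← lintegral_const_mul _ ((hm _ _).mul_const _)]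
  refine setLIntegral_congr_fun measurableSet_Ioi fun u hu => ?_
  have hu : 0 < u := hu
  rw [lintegral_Ioi_comp_mul_left u hu, ← lintegral_const_mul _ (by
      exact ((hm _ _).comp (measurable_const_mul u)).const_mul _),
    ← lintegral_const_mul _ (by
      exact (((hm _ _).comp (measurable_const_mul u)).const_mul _).const_mul _)]
  refine setLIntegral_congr_fun measurableSet_Ioi fun m hm => ?_
  have hm : 0 < m := hm
  have k1 := kKernel_nonneg j (4 * Real.pi * (t * a)) hu.le
  rw [← ENNReal.ofReal_mul hu.le, ← ENNReal.ofReal_mul k1, ← ENNReal.ofReal_mul (by positivity)]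
  congr 1
  have e : Real.exp (-(2 * Real.pi * ((a + m) * u + (a + m⁻¹) * u⁻¹) * t)) =
      Real.exp (-(4 * Real.pi * (t * a) / 2) * (u + u⁻¹)) *
        Real.exp (-(4 * Real.pi * t / 2) * (u * m + (u * m)⁻¹)) := by
    rw [← Real.exp_add, mul_inv]
    ring_nf
  have e2 : u ^ (j - 1) * u * u ^ (-j - 1) = u⁻¹ := by
    rw [← zpow_add_one₀ hu.ne', ← zpow_add₀ hu.ne', ← _root_.zpow_neg_one]
    congr 1
    ring
  rw [e, kKernel, kKernel, mul_zpow, ← e2]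
  ring

/-- Everything is nonnegative, so Tonelli allows integrating over `t` first (a Gamma integral), then
over `u` (a rational integral), leaving `m`. -/
theorem lintegral_kBessel_mul (j : ℤ) (hj : |j| ≤ 1) (a : ℝ) (ha : 0 < a) :
    ∫⁻ t in Set.Ioi 0, ENNReal.ofReal
      (t ^ 3 * (kBessel j (4 * Real.pi * (t * a)) * kBessel (-j) (4 * Real.pi * t))) =
    ∫⁻ m in Set.Ioi (0 : ℝ), ENNReal.ofReal
      (1 / (128 * Real.pi ^ 4) * (m ^ (1 - j) / ((a + m) ^ 2 * (1 + a * m) ^ 2))) := by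
  have hpi := Real.pi_pos
  have hmeas : Measurable fun p : ℝ × ℝ × ℝ => ENNReal.ofReal
      (1 / 4 * (p.2.1⁻¹ * p.2.2 ^ (-j - 1)) * (p.1 ^ 3 * Real.exp (-(2 * Real.pi *
        ((a + p.2.2) * p.2.1 + (a + p.2.2⁻¹) * p.2.1⁻¹) * p.1)))) := by
    fun_prop
  rw [setLIntegral_congr_fun measurableSet_Ioi
    fun t ht => ofReal_pow_three_mul_kBessel j hj a ha t ht]
  rw [lintegral_lintegral_swap (by
    apply Measurable.aemeasurable
    exact Measurable.lintegral_prod_right'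
      (f := fun q : (ℝ × ℝ) × ℝ => ENNReal.ofReal
        (1 / 4 * (q.1.2⁻¹ * q.2 ^ (-j - 1)) * (q.1.1 ^ 3 * Real.exp (-(2 * Real.pi *
          ((a + q.2) * q.1.2 + (a + q.2⁻¹) * q.1.2⁻¹) * q.1.1))))) (by fun_prop))]
  have hswap (u : ℝ) := lintegral_lintegral_swap (μ := volume.restrict (Set.Ioi (0 : ℝ)))
    (ν := volume.restrict (Set.Ioi (0 : ℝ))) (f := fun t m => ENNReal.ofReal
        (1 / 4 * (u⁻¹ * m ^ (-j - 1)) * (t ^ 3 * Real.exp (-(2 * Real.pi *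
          ((a + m) * u + (a + m⁻¹) * u⁻¹) * t))))) (by
      apply Measurable.aemeasurable
      unfold Function.uncurry
      fun_prop)
  simp only [hswap]
  rw [lintegral_lintegral_swap (by
    apply Measurable.aemeasurable
    exact Measurable.lintegral_prod_right'
      (f := fun q : (ℝ × ℝ) × ℝ => ENNReal.ofReal
        (1 / 4 * (q.1.1⁻¹ * q.1.2 ^ (-j - 1)) * (q.2 ^ 3 * Real.exp (-(2 * Real.pi *
          ((a + q.1.2) * q.1.1 + (a + q.1.2⁻¹) * q.1.1⁻¹) * q.2))))) (by fun_prop))]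
  refine setLIntegral_congr_fun measurableSet_Ioi fun m hm => ?_
  have hm : 0 < m := hm
  have hc : 0 ≤ 1 / 4 * m ^ (-j - 1) * (6 / (2 * Real.pi) ^ 4) := by positivity
  have key := lintegral_rational _ (a + m) (a + m⁻¹) hc (by positivity) (by positivity)
  refine Eq.trans (setLIntegral_congr_fun measurableSet_Ioi fun u hu => ?_) (key.trans ?_)
  · have hu : 0 < u := hu
    rw [lintegral_pow_three_mul_exp _ _ (by positivity) (by positivity)]
    congr 1
    -- Pulling `u⁻¹` out of the fourth power in the denominator gives `u⁴`, which with the prefactor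
    -- `u⁻¹` makes the `u³` of `lintegral_rational`.
    have e : (a + m) * u + (a + m⁻¹) * u⁻¹ = ((a + m) * u ^ 2 + (a + m⁻¹)) * u⁻¹ := by
      field_simp
    rw [e]
    have h0 : (a + m) * u ^ 2 + (a + m⁻¹) ≠ 0 := by positivity
    generalize (a + m) * u ^ 2 + (a + m⁻¹) = y at h0 ⊢
    field_simp
  · congr 1
    have e : m ^ (1 - j) = m ^ (-j - 1) * m ^ 2 := by
      rw [← zpow_natCast, ← zpow_add₀ hm.ne']
      congr 1
      push_cast
      ring
    have h2 : a + m⁻¹ = (1 + a * m) / m := by field_simp; ring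
    rw [e, h2]
    field_simp
    norm_num

theorem tendsto_log_ratio (a : ℝ) (ha : 0 < a) :
    Filter.Tendsto (fun m : ℝ => Real.log ((a + m) / (1 + a * m))) Filter.atTop
      (nhds (-Real.log a)) := by
  rw [← Real.log_inv]
  refine Filter.Tendsto.log ?_ (inv_ne_zero ha.ne')
  have h : Filter.Tendsto (fun m : ℝ => (a * m⁻¹ + 1) / (m⁻¹ + a)) Filter.atTop
      (nhds ((a * 0 + 1) / (0 + a))) :=
    ((tendsto_inv_atTop_zero.const_mul a).add_const 1).div (tendsto_inv_atTop_zero.add_const a)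
      (by positivity)
  rw [show (a * 0 + 1) / (0 + a) = a⁻¹ by simp] at h
  refine h.congr' ?_
  filter_upwards [Filter.eventually_gt_atTop 0] with m hm
  field_simp

theorem tendsto_inv_affine (b c : ℝ) (hc : 0 < c) :
    Filter.Tendsto (fun m : ℝ => (b + c * m)⁻¹) Filter.atTop (nhds 0) :=
  (Filter.tendsto_atTop_add_const_left _ _
    (Filter.tendsto_id.const_mul_atTop hc)).inv_tendsto_atTop

theorem hasDerivAt_log_ratio (a : ℝ) (ha : 0 < a) (m : ℝ) (hm : 0 ≤ m) :
    HasDerivAt (fun m : ℝ => Real.log ((a + m) / (1 + a * m)))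
      ((a + m)⁻¹ - a * (1 + a * m)⁻¹) m := by
  have h1 : 0 < a + m := by positivity
  have h2 : 0 < 1 + a * m := by positivity
  have d1 : HasDerivAt (fun m : ℝ => a + m) 1 m := (hasDerivAt_id m).const_add a
  have d2 : HasDerivAt (fun m : ℝ => 1 + a * m) a m := by
    simpa using ((hasDerivAt_id m).const_mul a).const_add 1
  refine ((d1.div d2 h2.ne').log (div_pos h1 h2).ne').congr_deriv ?_
  simp only [Pi.div_apply]
  field_simp

theorem hasDerivAt_inv_affine (b c m : ℝ) (h : b + c * m ≠ 0) :
    HasDerivAt (fun m : ℝ => (b + c * m)⁻¹) (-c / (b + c * m) ^ 2) m := by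
  have d2 : HasDerivAt (fun m : ℝ => b + c * m) c m := by
    simpa using ((hasDerivAt_id m).const_mul c).const_add b
  exact d2.inv h

theorem lintegral_rational_zero (k a : ℝ) (hk : 0 ≤ k) (ha : 0 < a) (ha1 : a < 1) :
    0 ≤ k * (1 / (1 - a ^ 2) ^ 2 *
        (-2 - 2 * (1 + a ^ 2) / (1 - a ^ 2) * Real.log a)) ∧
    ∫⁻ m in Set.Ioi (0 : ℝ), ENNReal.ofReal (k * (m / ((a + m) ^ 2 * (1 + a * m) ^ 2))) =
      ENNReal.ofReal (k * (1 / (1 - a ^ 2) ^ 2 *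
        (-2 - 2 * (1 + a ^ 2) / (1 - a ^ 2) * Real.log a))) := by
  have hc : 0 < 1 - a ^ 2 := by nlinarith
  refine lintegral_Ioi_ofReal_deriv
    -- Partial fractions in `a + m` and `1 + am`. The integrand decays faster than `1/m`, so the two
    -- logarithms have opposite coefficients and combine into one log of a ratio, running from `log
    -- a` to `-log a`.
    (g := fun m => k * (1 / (1 - a ^ 2) ^ 2 * ((1 + a ^ 2) / (1 - a ^ 2) *
      Real.log ((a + m) / (1 + a * m)) + (a * (a + 1 * m)⁻¹ + (1 + a * m)⁻¹))))
    (g' := fun m => k * (m / ((a + m) ^ 2 * (1 + a * m) ^ 2)))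
    (l := k * (1 / (1 - a ^ 2) ^ 2 * ((1 + a ^ 2) / (1 - a ^ 2) *
      (-Real.log a) + (a * 0 + 0)))) ?_ ?_ ?_ ?_
  · intro m hm
    have hm : 0 ≤ m := hm
    have h1 : 0 < a + m := by positivity
    have h2 : 0 < 1 + a * m := by positivity
    refine ((((hasDerivAt_log_ratio a ha m hm).const_mul _).add
      (((hasDerivAt_inv_affine a 1 m (by positivity)).const_mul a).add
        (hasDerivAt_inv_affine 1 a m h2.ne'))).const_mul _ |>.const_mul k).congr_deriv ?_
    rw [one_mul]
    field_simp
    ring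
  · intro m hm
    have : 0 < m := hm
    positivity
  · exact (((tendsto_log_ratio a ha).const_mul _).add
      (((tendsto_inv_affine a 1 one_pos).const_mul a).add
        (tendsto_inv_affine 1 a ha))).const_mul _ |>.const_mul k
  · simp only [add_zero, mul_zero, div_one, inv_one]
    field_simp
    ring

theorem lintegral_rational_one (k a : ℝ) (hk : 0 ≤ k) (ha : 0 < a) (ha1 : a < 1) :
    0 ≤ k * (1 / (1 - a ^ 2) ^ 2 *
        ((1 + a ^ 2) / a + 4 * a / (1 - a ^ 2) * Real.log a)) ∧
    ∫⁻ m in Set.Ioi (0 : ℝ), ENNReal.ofReal (k * (1 / ((a + m) ^ 2 * (1 + a * m) ^ 2))) =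
      ENNReal.ofReal (k * (1 / (1 - a ^ 2) ^ 2 *
        ((1 + a ^ 2) / a + 4 * a / (1 - a ^ 2) * Real.log a))) := by
  have hc : 0 < 1 - a ^ 2 := by nlinarith
  refine lintegral_Ioi_ofReal_deriv
    (g := fun m => k * (1 / (1 - a ^ 2) ^ 2 * (-(2 * a / (1 - a ^ 2)) *
      Real.log ((a + m) / (1 + a * m)) - ((a + 1 * m)⁻¹ + a * (1 + a * m)⁻¹))))
    (g' := fun m => k * (1 / ((a + m) ^ 2 * (1 + a * m) ^ 2)))
    (l := k * (1 / (1 - a ^ 2) ^ 2 * (-(2 * a / (1 - a ^ 2)) *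
      (-Real.log a) - (0 + a * 0)))) ?_ ?_ ?_ ?_
  · intro m hm
    have hm : 0 ≤ m := hm
    have h1 : 0 < a + m := by positivity
    have h2 : 0 < 1 + a * m := by positivity
    refine ((((hasDerivAt_log_ratio a ha m hm).const_mul _).sub
      ((hasDerivAt_inv_affine a 1 m (by positivity)).add
        ((hasDerivAt_inv_affine 1 a m h2.ne').const_mul a))).const_mul _ |>.const_mul
        k).congr_deriv ?_
    rw [one_mul]
    field_simp
    ring
  · intro m hm
    have : 0 < m := hm
    positivity
  · exact (((tendsto_log_ratio a ha).const_mul _).sub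
      ((tendsto_inv_affine a 1 one_pos).add
        ((tendsto_inv_affine 1 a ha).const_mul a))).const_mul _ |>.const_mul k
  · simp only [add_zero, mul_zero, div_one, inv_one]
    field_simp
    ring

/-- The integrand of the Mellin moment of a product of two Bessel functions. -/
def kProd (i j : ℤ) (a t : ℝ) : ℝ :=
  t ^ 3 * (kBessel i (4 * Real.pi * (t * a)) * kBessel j (4 * Real.pi * t))

theorem measurable_kProd (i j : ℤ) (a : ℝ) : Measurable (kProd i j a) := by
  have := measurable_kBessel i
  have := measurable_kBessel j
  unfold kProd
  fun_prop

theorem kProd_nonneg (i j : ℤ) (a t : ℝ) (ht : 0 < t) : 0 ≤ kProd i j a t := by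
  have := kBessel_nonneg i (4 * Real.pi * (t * a))
  have := kBessel_nonneg j (4 * Real.pi * t)
  unfold kProd
  positivity

theorem integrableOn_and_integral_of_lintegral_eq {f : ℝ → ℝ} (hf : Measurable f)
    (hpos : ∀ t ∈ Set.Ioi (0 : ℝ), 0 ≤ f t) {c : ℝ} (hc : 0 ≤ c)
    (h : ∫⁻ t in Set.Ioi 0, ENNReal.ofReal (f t) = ENNReal.ofReal c) :
    IntegrableOn f (Set.Ioi 0) ∧ ∫ t in Set.Ioi 0, f t = c := by
  have hae : 0 ≤ᵐ[volume.restrict (Set.Ioi (0 : ℝ))] f :=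
    (ae_restrict_iff' measurableSet_Ioi).mpr (Filter.Eventually.of_forall hpos)
  refine ⟨⟨hf.aestronglyMeasurable, ?_⟩, ?_⟩
  · rw [hasFiniteIntegral_iff_ofReal hae, h]
    exact ENNReal.ofReal_lt_top
  · rw [integral_eq_lintegral_of_nonneg_ae hae hf.aestronglyMeasurable, h,
      ENNReal.toReal_ofReal hc]

theorem kProd_zero_integral (a : ℝ) (ha : 0 < a) (ha1 : a < 1) :
    IntegrableOn (kProd 0 0 a) (Set.Ioi 0) ∧ ∫ t in Set.Ioi 0, kProd 0 0 a t =
      1 / (128 * Real.pi ^ 4) * (1 / (1 - a ^ 2) ^ 2 *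
        (-2 - 2 * (1 + a ^ 2) / (1 - a ^ 2) * Real.log a)) := by
  have h := lintegral_kBessel_mul 0 (by norm_num) a ha
  simp only [neg_zero, sub_zero, zpow_one] at h
  have hr := lintegral_rational_zero (1 / (128 * Real.pi ^ 4)) a (by positivity) ha ha1
  exact integrableOn_and_integral_of_lintegral_eq (measurable_kProd 0 0 a)
    (kProd_nonneg 0 0 a) hr.1 (h.trans hr.2)

theorem kProd_one_integral (a : ℝ) (ha : 0 < a) (ha1 : a < 1) :
    IntegrableOn (kProd 1 1 a) (Set.Ioi 0) ∧ ∫ t in Set.Ioi 0, kProd 1 1 a t =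
      1 / (128 * Real.pi ^ 4) * (1 / (1 - a ^ 2) ^ 2 *
        ((1 + a ^ 2) / a + 4 * a / (1 - a ^ 2) * Real.log a)) := by
  have h := lintegral_kBessel_mul 1 (by norm_num) a ha
  simp only [sub_self, zpow_zero, kBessel_neg] at h
  have hr := lintegral_rational_one (1 / (128 * Real.pi ^ 4)) a (by positivity) ha ha1
  exact integrableOn_and_integral_of_lintegral_eq (measurable_kProd 1 1 a)
    (kProd_nonneg 1 1 a) hr.1 (h.trans hr.2)

/-- Domination by the `K₁K₁` moment. This is all that is needed of the mixed products, whose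
coefficients integrate to zero over `x`. -/
theorem integrableOn_kProd_of_le {i j : ℤ} {a : ℝ} (ha : 0 < a) (ha1 : a < 1)
    (hi : ∀ x, 0 < x → kBessel i x ≤ kBessel 1 x) (hj : ∀ x, 0 < x → kBessel j x ≤ kBessel 1 x) :
    IntegrableOn (kProd i j a) (Set.Ioi 0) := by
  refine Integrable.mono' (kProd_one_integral a ha ha1).1
    (measurable_kProd i j a).aestronglyMeasurable ?_
  refine (ae_restrict_iff' measurableSet_Ioi).mpr (Filter.Eventually.of_forall fun t ht => ?_)
  have ht : 0 < t := ht
  rw [Real.norm_of_nonneg (kProd_nonneg i j a t ht)]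
  have hpi := Real.pi_pos
  exact mul_le_mul_of_nonneg_left (mul_le_mul (hi _ (by positivity)) (hj _ (by positivity))
    (kBessel_nonneg _ _) (kBessel_nonneg _ _)) (by positivity)

/-! ### Gaussian moments on one copy of `V_∞`. -/

/-- `f` is integrable with integral `c`. -/
def HasInt {α E : Type*} [MeasurableSpace α] [NormedAddCommGroup E] [NormedSpace ℝ E]
    (μ : Measure α) (f : α → E) (c : E) : Prop :=
  Integrable f μ ∧ ∫ x, f x ∂μ = c

theorem HasInt.add {α E : Type*} [MeasurableSpace α] [NormedAddCommGroup E] [NormedSpace ℝ E]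
    {μ : Measure α} {f g : α → E} {c d : E} (hf : HasInt μ f c) (hg : HasInt μ g d) :
    HasInt μ (fun x => f x + g x) (c + d) :=
  ⟨hf.1.add hg.1, by rw [integral_add hf.1 hg.1, hf.2, hg.2]⟩

theorem HasInt.const_mul {α 𝕜 : Type*} [MeasurableSpace α] [RCLike 𝕜]
    {μ : Measure α} {f : α → 𝕜} {c : 𝕜} (hf : HasInt μ f c) (r : 𝕜) :
    HasInt μ (fun x => r * f x) (r * c) :=
  ⟨hf.1.const_mul r, by rw [integral_const_mul, hf.2]⟩

theorem HasInt.ofReal {α : Type*} [MeasurableSpace α] {μ : Measure α} {f : α → ℝ} {c : ℝ}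
    (hf : HasInt μ f c) : HasInt μ (fun x => (f x : ℂ)) (c : ℂ) :=
  ⟨hf.1.ofReal, by rw [integral_complex_ofReal, hf.2]⟩

theorem HasInt.congr {α E : Type*} [MeasurableSpace α] [NormedAddCommGroup E] [NormedSpace ℝ E]
    {μ : Measure α} {f g : α → E} {c d : E} (hf : HasInt μ f c) (hfg : ∀ x, f x = g x)
    (hcd : c = d) : HasInt μ g d := by
  have : f = g := funext hfg
  rwa [← this, ← hcd]

theorem HasInt.congr_on {E : Type*} [NormedAddCommGroup E] [NormedSpace ℝ E] {s : Set ℝ}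
    (hs : MeasurableSet s) {f g : ℝ → E} {c : E} (hf : HasInt (volume.restrict s) f c)
    (hfg : ∀ x ∈ s, f x = g x) : HasInt (volume.restrict s) g c :=
  ⟨IntegrableOn.congr_fun hf.1 hfg hs, by rw [← setIntegral_congr_fun hs hfg, hf.2]⟩

theorem HasInt.mul_prod {α β : Type*} [MeasurableSpace α] [MeasurableSpace β] {μ : Measure α}
    {ν : Measure β} [SFinite μ] [SFinite ν] {f : α → ℝ} {g : β → ℝ} {c d : ℝ}
    (hf : HasInt μ f c) (hg : HasInt ν g d) :
    HasInt (μ.prod ν) (fun x => f x.1 * g x.2) (c * d) :=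
  ⟨hf.1.mul_prod hg.1, by rw [integral_prod_mul, hf.2, hg.2]⟩

/-- The moments of the one-dimensional Gaussian `exp (-c x²)` up to order two. -/
def gaussMoment (n : ℕ) (c : ℝ) : ℝ := ∫ x : ℝ, x ^ n * Real.exp (-c * x ^ 2)

theorem hasInt_gaussMoment (n : ℕ) {c : ℝ} (hc : 0 < c) :
    HasInt volume (fun x : ℝ => x ^ n * Real.exp (-c * x ^ 2)) (gaussMoment n c) := by
  refine ⟨?_, rfl⟩
  have := integrable_rpow_mul_exp_neg_mul_sq hc (s := n) (by
    have : (0 : ℝ) ≤ n := n.cast_nonneg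
    linarith)
  simpa using this

theorem gaussMoment_zero (c : ℝ) : gaussMoment 0 c = Real.sqrt (Real.pi / c) := by
  simp [gaussMoment, ← integral_gaussian]

theorem gaussMoment_one (c : ℝ) : gaussMoment 1 c = 0 := by
  have h := integral_neg_eq_self (fun x : ℝ => x ^ 1 * Real.exp (-c * x ^ 2)) volume
  have e : (fun x : ℝ => (-x) ^ 1 * Real.exp (-c * (-x) ^ 2)) =
      fun x : ℝ => -(x ^ 1 * Real.exp (-c * x ^ 2)) := by
    funext x
    rw [neg_sq]
    ring
  rw [e, integral_neg] at h
  unfold gaussMoment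
  linarith

theorem gaussMoment_two {c : ℝ} (hc : 0 < c) :
    gaussMoment 2 c = Real.sqrt (Real.pi / c) / (2 * c) := by
  have h0 := hasInt_gaussMoment 0 hc
  have h1 := hasInt_gaussMoment 1 hc
  have h2 := hasInt_gaussMoment 2 hc
  have hd := h0.add (h2.const_mul (-(2 * c)))
  -- The derivative of `x exp(-cx²)` has integral zero, which ties the second moment to the mass.
  have h := integral_eq_zero_of_hasDerivAt_of_integrable (f := fun x : ℝ =>
    x ^ 1 * Real.exp (-c * x ^ 2)) (fun x => ?_) hd.1 h1.1
  · rw [hd.2, gaussMoment_zero] at h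
    field_simp
    linarith
  · have e : HasDerivAt (fun x : ℝ => -c * x ^ 2) (-c * (2 * x)) x := by
      simpa using (hasDerivAt_pow 2 x).const_mul (-c)
    refine ((hasDerivAt_pow 1 x).mul e.exp).congr_deriv ?_
    simp
    ring

/-- The product of the Gaussians of `x` and `diag(a^(-1/2), a^(1/2)) x`, on one summand. -/
def weight (a : ℝ) (v : VCoord) : ℝ :=
  Real.exp (-(4 * Real.pi) * v.1.re ^ 2) * Real.exp (-(4 * Real.pi) * v.1.im ^ 2) *
    (Real.exp (-(Real.pi * (1 + (a ^ 2)⁻¹)) * v.2.1 ^ 2) *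
      Real.exp (-(Real.pi * (1 + a ^ 2)) * v.2.2 ^ 2))

theorem hasInt_monomial_weight (a : ℝ) (i j k l : ℕ) :
    HasInt volume (fun v : VCoord => v.1.re ^ i * v.1.im ^ j * v.2.1 ^ k * v.2.2 ^ l * weight a v)
      (gaussMoment i (4 * Real.pi) * gaussMoment j (4 * Real.pi) *
        (gaussMoment k (Real.pi * (1 + (a ^ 2)⁻¹)) * gaussMoment l (Real.pi * (1 + a ^ 2)))) := by
  have hpi := Real.pi_pos
  have h1 := (hasInt_gaussMoment i (c := 4 * Real.pi) (by positivity)).mul_prod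
    (hasInt_gaussMoment j (c := 4 * Real.pi) (by positivity))
  have h2 := (hasInt_gaussMoment k (c := Real.pi * (1 + (a ^ 2)⁻¹)) (by positivity)).mul_prod
    (hasInt_gaussMoment l (c := Real.pi * (1 + a ^ 2)) (by positivity))
  have h1' : HasInt volume (fun z : ℂ => z.re ^ i * Real.exp (-(4 * Real.pi) * z.re ^ 2) *
      (z.im ^ j * Real.exp (-(4 * Real.pi) * z.im ^ 2)))
      (gaussMoment i (4 * Real.pi) * gaussMoment j (4 * Real.pi)) :=
    ⟨(Complex.volume_preserving_equiv_real_prod.integrable_comp_emb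
      Complex.measurableEquivRealProd.measurableEmbedding).mpr h1.1,
      (Complex.volume_preserving_equiv_real_prod.integral_comp
        Complex.measurableEquivRealProd.measurableEmbedding _).trans h1.2⟩
  refine (h1'.mul_prod h2).congr (fun v => ?_) rfl
  simp only [weight]
  ring

/-- The mass of `weight a`. -/
def mass (a : ℝ) : ℝ := 1 / 4 * (a / (1 + a ^ 2))

theorem gaussMoment_zero_four_pi : gaussMoment 0 (4 * Real.pi) = 1 / 2 := by
  have hpi := Real.pi_pos
  rw [gaussMoment_zero, show Real.pi / (4 * Real.pi) = (1 / 2) ^ 2 by field_simp; norm_num,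
    Real.sqrt_sq (by norm_num)]

theorem gaussMoment_two_eq {c : ℝ} (hc : 0 < c) :
    gaussMoment 2 c = gaussMoment 0 c * (1 / (2 * c)) := by
  rw [gaussMoment_two hc, gaussMoment_zero]
  ring

theorem gaussMoment_zero_mul (a : ℝ) (ha : 0 < a) :
    gaussMoment 0 (Real.pi * (1 + (a ^ 2)⁻¹)) * gaussMoment 0 (Real.pi * (1 + a ^ 2)) =
      a / (1 + a ^ 2) := by
  have hpi := Real.pi_pos
  rw [gaussMoment_zero, gaussMoment_zero, ← Real.sqrt_mul (by positivity),
    show Real.pi / (Real.pi * (1 + (a ^ 2)⁻¹)) * (Real.pi / (Real.pi * (1 + a ^ 2))) =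
      (a / (1 + a ^ 2)) ^ 2 by field_simp; ring, Real.sqrt_sq (by positivity)]

/-- The half sum of the off-diagonal coordinates of `diag(a^(-1/2), a^(1/2)) x`. -/
def offHalfA (a : ℝ) (v : VCoord) : ℝ := offHalf (v.1, v.2.1 / a, a * v.2.2)

theorem hasInt_re_sq (a : ℝ) (ha : 0 < a) :
    HasInt volume (fun v => v.1.re ^ 2 * weight a v) (mass a * (1 / (8 * Real.pi))) := by
  have hpi := Real.pi_pos
  refine (hasInt_monomial_weight a 2 0 0 0).congr (fun v => by ring) ?_
  rw [gaussMoment_two_eq (by positivity), gaussMoment_zero_four_pi, gaussMoment_zero_mul a ha, mass]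
  ring

theorem hasInt_im_sq (a : ℝ) (ha : 0 < a) :
    HasInt volume (fun v => v.1.im ^ 2 * weight a v) (mass a * (1 / (8 * Real.pi))) := by
  have hpi := Real.pi_pos
  refine (hasInt_monomial_weight a 0 2 0 0).congr (fun v => by ring) ?_
  rw [gaussMoment_two_eq (by positivity), gaussMoment_zero_four_pi, gaussMoment_zero_mul a ha, mass]
  ring

theorem hasInt_re_mul_im (a : ℝ) :
    HasInt volume (fun v => v.1.re * v.1.im * weight a v) 0 := by
  refine (hasInt_monomial_weight a 1 1 0 0).congr (fun v => by ring) ?_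
  rw [gaussMoment_one]
  ring

theorem hasInt_re_mul_offHalf (a : ℝ) :
    HasInt volume (fun v => v.1.re * offHalf v * weight a v) 0 := by
  refine (((hasInt_monomial_weight a 1 0 1 0).add (hasInt_monomial_weight a 1 0 0 1)).const_mul
    (1 / 2)).congr (fun v => by rw [offHalf]; ring) ?_
  rw [gaussMoment_one]
  ring

theorem hasInt_im_mul_offHalf (a : ℝ) :
    HasInt volume (fun v => v.1.im * offHalf v * weight a v) 0 := by
  refine (((hasInt_monomial_weight a 0 1 1 0).add (hasInt_monomial_weight a 0 1 0 1)).const_mul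
    (1 / 2)).congr (fun v => by rw [offHalf]; ring) ?_
  rw [gaussMoment_one]
  ring

theorem hasInt_re_mul_offHalfA (a : ℝ) :
    HasInt volume (fun v => v.1.re * offHalfA a v * weight a v) 0 := by
  refine (((hasInt_monomial_weight a 1 0 1 0).const_mul (1 / (2 * a))).add
    ((hasInt_monomial_weight a 1 0 0 1).const_mul (a / 2))).congr
    (fun v => by rw [offHalfA, offHalf]; ring) ?_
  rw [gaussMoment_one]
  ring

theorem hasInt_im_mul_offHalfA (a : ℝ) :
    HasInt volume (fun v => v.1.im * offHalfA a v * weight a v) 0 := by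
  refine (((hasInt_monomial_weight a 0 1 1 0).const_mul (1 / (2 * a))).add
    ((hasInt_monomial_weight a 0 1 0 1).const_mul (a / 2))).congr
    (fun v => by rw [offHalfA, offHalf]; ring) ?_
  rw [gaussMoment_one]
  ring

theorem hasInt_offHalf_mul_offHalfA (a : ℝ) (ha : 0 < a) :
    HasInt volume (fun v => offHalf v * offHalfA a v * weight a v)
      (mass a * (a / (4 * Real.pi * (1 + a ^ 2)))) := by
  have hpi := Real.pi_pos
  refine ((((hasInt_monomial_weight a 0 0 2 0).const_mul (1 / (4 * a))).add
    ((hasInt_monomial_weight a 0 0 0 2).const_mul (a / 4))).add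
    ((hasInt_monomial_weight a 0 0 1 1).const_mul ((a + 1 / a) / 4))).congr
    (fun v => by simp only [offHalfA, offHalf]; field_simp; ring) ?_
  rw [gaussMoment_one, gaussMoment_two_eq (by positivity), gaussMoment_two_eq (by positivity)]
  have h := gaussMoment_zero_mul a ha
  generalize gaussMoment 0 (Real.pi * (1 + (a ^ 2)⁻¹)) = A at h ⊢
  generalize gaussMoment 0 (Real.pi * (1 + a ^ 2)) = B at h ⊢
  -- The `q²` and `r²` terms contribute equally, `a / (8π(1 + a²))` each; the `qr` term is odd and
  -- has dropped out.
  have e : 1 / (4 * a) * (1 / (2 * (Real.pi * (1 + (a ^ 2)⁻¹)))) +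
      a / 4 * (1 / (2 * (Real.pi * (1 + a ^ 2)))) = a / (4 * Real.pi * (1 + a ^ 2)) := by
    field_simp
    ring
  rw [gaussMoment_zero_four_pi, mass, ← h, ← e]
  ring

/-! ### Gaussian averages of the alternating forms on two copies. -/

/-- The imaginary part of `p₁ p̄₂`. -/
def imCross (x : VCoord × VCoord) : ℝ := x.1.1.im * x.2.1.re - x.1.1.re * x.2.1.im

/-- The mixed form in the real parts of the `pᵢ` and the off-diagonal half sums. -/
def reCross (x : VCoord × VCoord) : ℝ := x.1.1.re * offHalf x.2 - x.2.1.re * offHalf x.1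

/-- The form `reCross` at `diag(a^(-1/2), a^(1/2)) x`. -/
def reCrossA (a : ℝ) (x : VCoord × VCoord) : ℝ :=
  x.1.1.re * offHalfA a x.2 - x.2.1.re * offHalfA a x.1

/-- The weight on both summands. -/
def weight₂ (a : ℝ) (x : VCoord × VCoord) : ℝ := weight a x.1 * weight a x.2

theorem hasInt_imCross_sq (a : ℝ) (ha : 0 < a) :
    HasInt volume (fun x => imCross x ^ 2 * weight₂ a x)
      (2 * (mass a * (1 / (8 * Real.pi))) ^ 2) := by
  refine ((((hasInt_im_sq a ha).mul_prod (hasInt_re_sq a ha)).add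
    ((hasInt_re_sq a ha).mul_prod (hasInt_im_sq a ha))).add
    (((hasInt_re_mul_im a).mul_prod (hasInt_re_mul_im a)).const_mul (-2))).congr
    (fun x => ?_) (by ring)
  simp only [imCross, weight₂]
  ring

theorem hasInt_reCross_mul_reCrossA (a : ℝ) (ha : 0 < a) :
    HasInt volume (fun x => reCrossA a x * reCross x * weight₂ a x)
      (2 * (mass a * (1 / (8 * Real.pi))) * (mass a * (a / (4 * Real.pi * (1 + a ^ 2))))) := by
  refine ((((hasInt_re_sq a ha).mul_prod (hasInt_offHalf_mul_offHalfA a ha)).add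
    ((hasInt_offHalf_mul_offHalfA a ha).mul_prod (hasInt_re_sq a ha))).add
    ((((hasInt_re_mul_offHalf a).mul_prod (hasInt_re_mul_offHalfA a)).add
      ((hasInt_re_mul_offHalfA a).mul_prod (hasInt_re_mul_offHalf a))).const_mul (-1))).congr
    (fun x => ?_) (by ring)
  simp only [reCross, reCrossA, weight₂]
  ring

/-- Changing the sign of both `Im pᵢ` negates `imCross` and fixes `reCross` and the weight. In the
expansion, every monomial has a factor of vanishing mean. -/
theorem hasInt_imCross_mul_reCross (a : ℝ) :
    HasInt volume (fun x => imCross x * reCross x * weight₂ a x) 0 := by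
  have hs := hasInt_monomial_weight a 2 0 0 0
  refine (((((hasInt_re_mul_im a).mul_prod (hasInt_re_mul_offHalf a)).add
    ((hasInt_re_mul_offHalf a).mul_prod (hasInt_re_mul_im a))).add
    (((hasInt_im_mul_offHalf a).mul_prod hs).const_mul (-1))).add
    ((hs.mul_prod (hasInt_im_mul_offHalf a)).const_mul (-1))).congr
    (fun x => ?_) (by ring)
  simp only [reCross, imCross, weight₂]
  ring

theorem hasInt_imCross_mul_reCrossA (a : ℝ) :
    HasInt volume (fun x => imCross x * reCrossA a x * weight₂ a x) 0 := by
  have hs := hasInt_monomial_weight a 2 0 0 0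
  refine (((((hasInt_re_mul_im a).mul_prod (hasInt_re_mul_offHalfA a)).add
    ((hasInt_re_mul_offHalfA a).mul_prod (hasInt_re_mul_im a))).add
    (((hasInt_im_mul_offHalfA a).mul_prod hs).const_mul (-1))).add
    ((hs.mul_prod (hasInt_im_mul_offHalfA a)).const_mul (-1))).congr
    (fun x => ?_) (by ring)
  simp only [reCrossA, imCross, weight₂]
  ring

/-! ### The integrals over `t` and `x`. -/

/-- As `K₋₁ = K₁`, the terms in `p` and `p̄` add up to `2 Re p`, so the coefficient of `K₁` is real.
-/
theorem pairing_vMat_whittakerTorus_eq (v w : VCoord) (t : ℝ) :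
    pairing 2 (symToPoly (symPart (symPart (vMat v) * w₀ * symPart (vMat w))))
      (whittakerTorus 0 t) = 32 * (t : ℂ) ^ 2 *
      (Complex.I * (imCross (v, w) : ℂ) * (kBessel 0 (4 * Real.pi * t) : ℂ) -
        (reCross (v, w) : ℂ) * (kBessel 1 (4 * Real.pi * t) : ℂ)) := by
  have h0 := besselK_ofReal 0 (4 * Real.pi * t)
  have h1 := besselK_ofReal 1 (4 * Real.pi * t)
  have h2 := besselK_ofReal (-1) (4 * Real.pi * t)
  rw [kBessel_neg] at h2
  push_cast at h0 h1 h2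
  rw [pairing_vMat_whittakerTorus, h0, h1, h2, imCross, reCross]
  have hv := Complex.add_conj v.1
  have hw := Complex.add_conj w.1
  push_cast at hv hw ⊢
  linear_combination (-16 * (t : ℂ) ^ 2 * (kBessel 1 (4 * Real.pi * t) : ℂ)) *
    ((offHalf w : ℂ) * hv - (offHalf v : ℂ) * hw)

theorem gaussian_mul_gaussian (a : ℝ) (x : VCoord × VCoord) :
    gaussian (vMat (x.1.1, x.1.2.1 / a, a * x.1.2.2)) (vMat (x.2.1, x.2.2.1 / a, a * x.2.2.2)) *
      gaussian (vMat x.1) (vMat x.2) = (weight₂ a x : ℂ) := by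
  rw [gaussian_vMat, gaussian_vMat, ← Complex.ofReal_mul, weight₂, weight, weight]
  simp only [← Real.exp_add]
  congr 2
  ring

/-- The constant and the `t³` inside `kProd` come from `32(ta)² · 32t² / t = 1024 a² t³`. The twist
fixes each `p`, hence `imCross`. -/
theorem integrand_zero (a : ℝ) (ha : 0 < a) (x : VCoord × VCoord) (t : ℝ) (ht : 0 < t) :
    integrand 0 a x t = ((1024 * a ^ 2 * weight₂ a x : ℝ) : ℂ) *
      (((imCross x ^ 2 : ℝ) : ℂ) * (kProd 0 0 a t : ℂ) +
        ((reCrossA a x * reCross x : ℝ) : ℂ) * (kProd 1 1 a t : ℂ) +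
        Complex.I * (((imCross x * reCrossA a x : ℝ) : ℂ) * (kProd 1 0 a t : ℂ) +
          ((-(imCross x * reCross x) : ℝ) : ℂ) * (kProd 0 1 a t : ℂ))) := by
  have ht' : (t : ℂ) ≠ 0 := by exact_mod_cast ht.ne'
  rw [integrand, whittaker_diagT 0 t ht, whittaker_diagT_mul_diagA 0 t a ht ha,
    act_diagAInv_vMat a ha, act_diagAInv_vMat a ha, mul_zero, zero_add,
    contract_schwartzPhi_zero, contract_schwartzPhi_zero, pairing_zero_smul_one,
    pairing_vMat_whittakerTorus_eq, pairing_vMat_whittakerTorus_eq]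
  have hg : conj (gaussian (vMat x.1) (vMat x.2)) = gaussian (vMat x.1) (vMat x.2) := by
    rw [gaussian_vMat, Complex.conj_ofReal]
  have hi : imCross ((x.1.1, x.1.2.1 / a, a * x.1.2.2), (x.2.1, x.2.2.1 / a, a * x.2.2.2)) =
    imCross x := rfl
  have hr : reCross ((x.1.1, x.1.2.1 / a, a * x.1.2.2), (x.2.1, x.2.2.1 / a, a * x.2.2.2)) =
    reCrossA a x := rfl
  rw [hi, hr]
  simp only [map_mul, map_sub, map_pow, Complex.conj_ofReal, Complex.conj_I, hg, map_ofNat]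
  push_cast [← gaussian_mul_gaussian, kProd]
  field_simp
  ring_nf
  simp only [Complex.I_sq]
  ring_nf

/-- The value of the inner integral. -/
theorem hasInt_integrand (a : ℝ) (ha : 0 < a) (ha1 : a < 1) (x : VCoord × VCoord) :
    HasInt (volume.restrict (Set.Ioi 0)) (integrand 0 a x)
      (((1024 * a ^ 2 * weight₂ a x : ℝ) : ℂ) *
      (((imCross x ^ 2 : ℝ) : ℂ) * ((∫ t in Set.Ioi 0, kProd 0 0 a t : ℝ) : ℂ) +
        ((reCrossA a x * reCross x : ℝ) : ℂ) * ((∫ t in Set.Ioi 0, kProd 1 1 a t : ℝ) : ℂ) +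
        Complex.I * (((imCross x * reCrossA a x : ℝ) : ℂ) *
            ((∫ t in Set.Ioi 0, kProd 1 0 a t : ℝ) : ℂ) +
          ((-(imCross x * reCross x) : ℝ) : ℂ) *
            ((∫ t in Set.Ioi 0, kProd 0 1 a t : ℝ) : ℂ)))) := by
  have h (i j : ℤ) (hi : ∀ x, 0 < x → kBessel i x ≤ kBessel 1 x)
      (hj : ∀ x, 0 < x → kBessel j x ≤ kBessel 1 x) :
      HasInt (volume.restrict (Set.Ioi 0)) (fun t => (kProd i j a t : ℂ))
        ((∫ t in Set.Ioi 0, kProd i j a t : ℝ) : ℂ) :=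
    HasInt.ofReal ⟨integrableOn_kProd_of_le ha ha1 hi hj, rfl⟩
  have l0 := kBessel_zero_le_one
  have l1 : ∀ x : ℝ, 0 < x → kBessel 1 x ≤ kBessel 1 x := fun _ _ => le_rfl
  exact (((((h 0 0 l0 l0).const_mul _).add ((h 1 1 l1 l1).const_mul _)).add
    ((((h 1 0 l1 l0).const_mul _).add ((h 0 1 l0 l1).const_mul _)).const_mul _)).const_mul
    _).congr_on measurableSet_Ioi fun t ht => (integrand_zero a ha x t ht).symm

theorem hasInt_intT (a : ℝ) (ha : 0 < a) (ha1 : a < 1) :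
    HasInt volume (intT 0 a) ((1024 * a ^ 2 * (2 * (mass a * (1 / (8 * Real.pi))) ^ 2 *
        ∫ t in Set.Ioi 0, kProd 0 0 a t) + 1024 * a ^ 2 *
      (2 * (mass a * (1 / (8 * Real.pi))) * (mass a * (a / (4 * Real.pi * (1 + a ^ 2)))) *
        ∫ t in Set.Ioi 0, kProd 1 1 a t) : ℝ) : ℂ) := by
  have hT (x) : intT 0 a x = _ := (hasInt_integrand a ha ha1 x).2
  refine (((hasInt_imCross_sq a ha).ofReal.const_mul
      ((1024 * a ^ 2 * ∫ t in Set.Ioi 0, kProd 0 0 a t : ℝ) : ℂ)).add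
    ((hasInt_reCross_mul_reCrossA a ha).ofReal.const_mul
      ((1024 * a ^ 2 * ∫ t in Set.Ioi 0, kProd 1 1 a t : ℝ) : ℂ)) |>.add
    (((hasInt_imCross_mul_reCrossA a).ofReal.const_mul
      ((1024 * a ^ 2 * ∫ t in Set.Ioi 0, kProd 1 0 a t : ℝ) : ℂ)).add
    ((hasInt_imCross_mul_reCross a).ofReal.const_mul
      (-(1024 * a ^ 2 * ∫ t in Set.Ioi 0, kProd 0 1 a t : ℝ) : ℂ)) |>.const_mul
        Complex.I)).congr (fun x => ?_) ?_
  · rw [hT]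
    push_cast
    ring
  · push_cast
    ring

/-! ### The integral over `a`. -/

/-- The outer integrand in closed form. -/
def outerReal (a : ℝ) : ℝ :=
  1 / (2 ^ 7 * Real.pi ^ 6) * (a * (-4 * (1 - a ^ 2) * Real.log a) / (1 + a ^ 2) ^ 3)

/-- Up to a common factor the sum over the two moments is the bracket of `K₀K₀` plus `2a/(1 + a²)`
times that of `K₁K₁`. The terms `-2` and `+2` cancel, and since `(1 + a²)² - 4a² = (1 - a²)²` the
logarithm keeps the coefficient `-2(1 - a²)/(1 + a²)`. The density cancels the remaining `(1 -
a²)⁻²`. -/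
theorem outerIntegrand_zero (a : ℝ) (ha : 0 < a) (ha1 : a < 1) :
    outerIntegrand 0 a = (outerReal a : ℂ) := by
  have hpi := Real.pi_pos
  have hc : 1 - a ^ 2 ≠ 0 := by nlinarith
  have hX : intX 0 a = _ := (hasInt_intT a ha ha1).2
  rw [outerIntegrand, hX, ← Complex.ofReal_mul, (kProd_zero_integral a ha ha1).2,
    (kProd_one_integral a ha ha1).2, outerReal, mass]
  congr 1
  field_simp
  ring

/-- An antiderivative of `outerReal`. -/
def outerPrim (a : ℝ) : ℝ :=
  1 / (2 ^ 8 * Real.pi ^ 6) * (-4 * (a * (a * Real.log a)) / (1 + a ^ 2) ^ 2 - 2 / (1 + a ^ 2))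

theorem hasDerivAt_outerPrim (a : ℝ) (ha : 0 < a) : HasDerivAt outerPrim (outerReal a) a := by
  have hd : HasDerivAt (fun a : ℝ => 1 + a ^ 2) (2 * a) a := by
    simpa using (hasDerivAt_pow 2 a).const_add 1
  have hl := (hasDerivAt_id a).mul ((hasDerivAt_id a).mul (Real.hasDerivAt_log ha.ne'))
  have h1 : (1 + a ^ 2) ≠ 0 := by positivity
  refine ((((hl.const_mul (-4)).div (hd.pow 2) (pow_ne_zero 2 h1)).sub
    ((hasDerivAt_const a (2 : ℝ)).div hd h1)).const_mul
    (1 / (2 ^ 8 * Real.pi ^ 6))).congr_deriv ?_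
  have hpi := Real.pi_pos
  simp only [outerReal, Pi.mul_apply, Pi.pow_apply, id]
  field_simp
  ring

/-- Only `a log a` could fail at `0`; it is continuous there with the convention `log 0 = 0`, which
is why the primitive is written with `a * (a * log a)`. -/
theorem continuous_outerPrim : Continuous outerPrim := by
  have := Real.continuous_mul_log
  unfold outerPrim
  refine continuous_const.mul (Continuous.sub (Continuous.div (by fun_prop) (by fun_prop) ?_)
    (Continuous.div (by fun_prop) (by fun_prop) ?_)) <;>
  · intro x
    positivity

theorem hasInt_outerReal :
    HasInt (volume.restrict (Set.Ioo 0 1)) outerReal (1 / (2 ^ 8 * Real.pi ^ 6)) := by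
  -- Integrability is free here: a nonnegative derivative of a function continuous up to the
  -- endpoints.
  have hi : IntegrableOn outerReal (Set.Ioc 0 1) := by
    refine intervalIntegral.integrableOn_deriv_of_nonneg continuous_outerPrim.continuousOn
      (fun x hx => hasDerivAt_outerPrim x hx.1) fun x hx => ?_
    have h0 := hx.1
    have h1 : 0 ≤ 1 - x ^ 2 := by nlinarith [hx.1, hx.2]
    have h2 : 0 ≤ -Real.log x := by linarith [Real.log_nonpos hx.1.le hx.2.le]
    have e : -4 * (1 - x ^ 2) * Real.log x = 4 * (1 - x ^ 2) * -Real.log x := by ring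
    rw [outerReal, e]
    positivity
  refine ⟨hi.mono_set Set.Ioo_subset_Ioc_self, ?_⟩
  rw [← integral_Ioc_eq_integral_Ioo, ← intervalIntegral.integral_of_le zero_le_one,
    intervalIntegral.integral_eq_sub_of_hasDerivAt_of_le zero_le_one
      continuous_outerPrim.continuousOn (fun x hx => hasDerivAt_outerPrim x hx.1)
      ((intervalIntegrable_iff_integrableOn_Ioc_of_le zero_le_one).mpr hi)]
  -- In units of `1/(2⁸π⁶)` the primitive is `-1` at `1` and `-2` at `0`.
  simp only [outerPrim, Real.log_one]
  norm_num
  ring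

theorem hasInt_outerIntegrand :
    HasInt (volume.restrict (Set.Ioo 0 1)) (outerIntegrand 0)
      ((1 / (2 ^ 8 * Real.pi ^ 6) : ℝ) : ℂ) :=
  hasInt_outerReal.ofReal.congr_on measurableSet_Ioo fun a ha =>
    (outerIntegrand_zero a ha.1 ha.2).symm

theorem archIConverges_zero : ArchIConverges 0 :=
  ⟨fun a ha x => (hasInt_integrand a ha.1 ha.2 x).1, fun a ha => (hasInt_intT a ha.1 ha.2).1,
    hasInt_outerIntegrand.1⟩

theorem archI_zero : archI 0 = (2 : ℂ) ^ (-8 : ℤ) * (Real.pi : ℂ) ^ (-6 : ℤ) := by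
  rw [archI, hasInt_outerIntegrand.2]
  push_cast
  rw [_root_.zpow_neg, _root_.zpow_neg, zpow_ofNat, zpow_ofNat, one_div, mul_inv]

end ArchInt

end

theorem mainTheorem8 :
    ArchInt.ArchIConverges 0 ∧
    ArchInt.archI 0 = (2 : ℂ) ^ (-8 : ℤ) * (Real.pi : ℂ) ^ (-6 : ℤ) ∧
    ArchInt.ArchIFormula 0 := by
  refine ⟨ArchInt.archIConverges_zero, ArchInt.archI_zero, ?_⟩
  rw [ArchInt.ArchIFormula, ArchInt.archI_zero]
  simp
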